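/- Let $L,P_1,P_2>0$, $D=(0,L)\times\mathbb{R}^2$, $\mathcal{P}=(0,L)\times(0,P_1)\times(0,P_2)$; "periodic" means $P_1$-periodic in $y$ and $P_2$-periodic in $z$. Let $\bar f,\bar g\in C^\infty(\overline D)$ have constant gradients, put $\bar v=\nabla\bar f\times\nabla\bar g$, and assume that the first component of $\bar v$ does not vanish and that $$|\nabla\bar f|^2+|\nabla\bar g|^2+\sqrt{(|\nabla\bar f|^2+|\nabla\bar g|^2)^2-4|\bar v|^2}\le 2 .$$ For $f,g\in C^3(\overline D)$ with $\nabla f,\nabla g$ periodic, put $v=\nabla f\times\nabla g$. For $H\in C^2(\mathbb{R}^2)$ with $H''(f,g)$ periodic, and for periodic $F,G,\delta F,\delta G\in H^1_{loc}(D)$ with zero trace on $\partial D=\{0,L\}\times\mathbb{R}^2$, put $$\begin{aligned}B_{(f,g)}((F,G),(\delta F,\delta G))=\int_{\mathcal{P}}\Big\{&(\nabla F\times\nabla g+\nabla f\times\nabla G)\cdot(\nabla\delta F\times\nabla g+\nabla f\times\nabla\delta G)\\&+v\cdot(\nabla F\times\nabla\delta G)+v\cdot(\nabla\delta F\times\nabla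 G)\\&+\partial_f^2H(f,g)F\,\delta F+\partial_f\partial_gH(f,g)(F\,\delta G+G\,\delta F)+\partial_g^2H(f,g)G\,\delta G\Big\}\,dx\,dy\,dz.\end{aligned}$$ Here $H^1_{loc}(D)$ consists of the functions that belong to $H^1(U)$ for every bounded open $U\subset D$ (so $\overline U\subset D$ is not required). **Theorem.** There exist constants $C\ge0$ and $\delta>0$, depending only on $L,P_1,P_2,\bar f,\bar g$, such that for all $f,g\in C^3(\overline D)$ with $\nabla f,\nabla g$ periodic and $$\|\nabla f-\nabla\bar f\|_{C^2(\overline{\mathcal{P}})}+\|\nabla g-\nabla\bar g\|_{C^2(\overline{\mathcal{P}})}<\delta,$$ all $H\in C^2(\mathbb{R}^2)$ with $H''(f,g)$ periodic, and all periodic $F,G\in H^1_{loc}(D)$ with zero trace on $\partial D$, $$\begin{aligned}B_{(f,g)}((F,G),(F,G))\ge\int_{\mathcal{P}}\Big\{&\tfrac1{16}(v\cdot\nabla F)^2+\tfrac1{16}(v\cdot\nabla G)^2+\big(1-C\|v'\|_{C(\overline{\mathcal{P}})}\big)\frac{\pi^2\min_{\overline{\mathcal{P}}}v_1^2}{16L^2}(F^2+G^2)\\&+\partial_f^2H(f,g)F^2+2\,\partial_f\partial_gH(f,g)FG+\partial_g^2H(f,g)G^2\Big\}\,dx\,dy\,dz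 .\end{aligned}$$ -/

import Mathlib

open Set Filter Topology MeasureTheory
open scoped ContDiff

noncomputable section

namespace SteadyEuler

/-- Three-dimensional Euclidean space, with coordinates `(x, y, z) = (p 0, p 1, p 2)`. -/
abbrev E3 : Type := EuclideanSpace ℝ (Fin 3)

/-- The point `(x, y, z)`. -/
def pt (x y z : ℝ) : E3 := !₂[x, y, z]

/-- The cross product on `E3`. -/
def cross (a b : E3) : E3 := WithLp.toLp 2 (crossProduct a.ofLp b.ofLp)

/-- The dot product on `E3`. -/
def dot (a b : E3) : ℝ := inner ℝ a b

/-- The open slab `D = (0, L) × ℝ²`. -/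
def slab (L : ℝ) : Set E3 := {p | p 0 ∈ Ioo 0 L}

/-- The closed slab `[0, L] × ℝ²`. -/
def closedSlab (L : ℝ) : Set E3 := {p | p 0 ∈ Icc 0 L}

/-- The open periodicity cell `(0, L) × (0, P₁) × (0, P₂)`. -/
def cell (L P₁ P₂ : ℝ) : Set E3 :=
  {p | p 0 ∈ Ioo 0 L ∧ p 1 ∈ Ioo 0 P₁ ∧ p 2 ∈ Ioo 0 P₂}

/-- The closed periodicity cell `[0, L] × [0, P₁] × [0, P₂]`. -/
def closedCell (L P₁ P₂ : ℝ) : Set E3 :=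
  {p | p 0 ∈ Icc 0 L ∧ p 1 ∈ Icc 0 P₁ ∧ p 2 ∈ Icc 0 P₂}

/-- `u` is `(P₁, P₂)`-periodic in `(y, z)` on the closed slab. -/
def PeriodicYZ {α : Type*} (L P₁ P₂ : ℝ) (u : E3 → α) : Prop :=
  ∀ p ∈ closedSlab L, u (p + pt 0 P₁ 0) = u p ∧ u (p + pt 0 0 P₂) = u p

/-- `u` is `(P₁, P₂)`-periodic in `(y, z)` almost everywhere on the open slab. -/
def AEPeriodicYZ {α : Type*} (L P₁ P₂ : ℝ) (u : E3 → α) : Prop :=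
  ∀ᵐ p ∂(volume.restrict (slab L)), u (p + pt 0 P₁ 0) = u p ∧ u (p + pt 0 0 P₂) = u p

/-- The classical gradient `∇f` on the closed slab (one-sided in `x` at `x = 0` and `x = L`). -/
def grad (L : ℝ) (f : E3 → ℝ) (p : E3) : E3 := gradientWithin f (closedSlab L) p

/-- The velocity field `v = ∇f × ∇g`. -/
def velocity (L : ℝ) (f g : E3 → ℝ) (p : E3) : E3 := cross (grad L f p) (grad L g p)

/-- The `C^k` norm over the closed cell of a function of class `C^k` on the closed slab: the sum
over `j ≤ k` of the maxima over the closed cell of the norms of the `j`-th derivatives. -/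
def cNorm {V : Type*} [NormedAddCommGroup V] [NormedSpace ℝ V]
    (L P₁ P₂ : ℝ) (k : ℕ) (u : E3 → V) : ℝ :=
  ∑ j ∈ Finset.range (k + 1),
    sSup ((fun p => ‖iteratedFDerivWithin ℝ j u (closedSlab L) p‖) '' closedCell L P₁ P₂)

/-- The maximum over the closed cell of the norm of the derivative `v'` of `v`. -/
def derivSup (L P₁ P₂ : ℝ) (v : E3 → E3) : ℝ :=
  sSup ((fun p => ‖fderivWithin ℝ v (closedSlab L) p‖) '' closedCell L P₁ P₂)

/-- The minimum over the closed cell of the square of the first component of `v`. -/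
def minSqFst (L P₁ P₂ : ℝ) (v : E3 → E3) : ℝ :=
  sInf ((fun p => (v p 0) ^ 2) '' closedCell L P₁ P₂)

/-- Admissible pairs `(f, g)`: of class `C³` up to the boundary of the slab, with gradients
periodic in `(y, z)`. -/
structure AdmissiblePair (L P₁ P₂ : ℝ) (f g : E3 → ℝ) : Prop where
  contDiff_fst : ContDiffOn ℝ 3 f (closedSlab L)
  contDiff_snd : ContDiffOn ℝ 3 g (closedSlab L)
  periodic_fst : PeriodicYZ L P₁ P₂ (grad L f)
  periodic_snd : PeriodicYZ L P₁ P₂ (grad L g)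

/-- The second derivative `H''`, as a bilinear form. -/
def hess (H : ℝ × ℝ → ℝ) (q : ℝ × ℝ) : ℝ × ℝ →L[ℝ] ℝ × ℝ →L[ℝ] ℝ :=
  fderiv ℝ (fderiv ℝ H) q

/-- `∂_f² H`. -/
def Hff (H : ℝ × ℝ → ℝ) (q : ℝ × ℝ) : ℝ := hess H q (1, 0) (1, 0)

/-- `∂_f ∂_g H`. -/
def Hfg (H : ℝ × ℝ → ℝ) (q : ℝ × ℝ) : ℝ := hess H q (1, 0) (0, 1)

/-- `∂_g² H`. -/
def Hgg (H : ℝ × ℝ → ℝ) (q : ℝ × ℝ) : ℝ := hess H q (0, 1) (0, 1)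

/-- `H` is admissible for `(f, g)`: it is of class `C²` and `H''(f, g)` is periodic. -/
structure AdmissibleH (L P₁ P₂ : ℝ) (f g : E3 → ℝ) (H : ℝ × ℝ → ℝ) : Prop where
  contDiff : ContDiff ℝ 2 H
  periodic : PeriodicYZ L P₁ P₂ (fun p => hess H (f p, g p))

/-- `F` belongs to `H¹(U)` for every bounded open subset `U` of the slab `D` (`U` may touch the
boundary of `D`), and `W` is its weak gradient. -/
structure HasWeakGrad (L : ℝ) (F : E3 → ℝ) (W : E3 → E3) : Prop where
  memLp : ∀ U : Set E3, IsOpen U → Bornology.IsBounded U → U ⊆ slab L →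
    MemLp F 2 (volume.restrict U)
  memLp_grad : ∀ U : Set E3, IsOpen U → Bornology.IsBounded U → U ⊆ slab L →
    MemLp W 2 (volume.restrict U)
  integral_eq : ∀ φ : E3 → ℝ, ContDiff ℝ ∞ φ → HasCompactSupport φ → tsupport φ ⊆ slab L →
    ∫ p in slab L, F p • gradient φ p = - ∫ p in slab L, φ p • W p

/-- `T` is the trace on `{0, L} × ℝ²` of the function `F`, which has weak gradient `W`: the trace
operator is the continuous extension of the restriction `u ↦ u|_{∂D}` of smooth functions, from the
topology of `H¹` on bounded subsets of the slab to that of `L²` on bounded subsets of its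
boundary. -/
def HasTrace (L : ℝ) (F : E3 → ℝ) (W : E3 → E3) (T : E3 → ℝ) : Prop :=
  ∃ u : ℕ → E3 → ℝ, (∀ n, ContDiff ℝ ∞ (u n)) ∧
    (∀ U : Set E3, IsOpen U → Bornology.IsBounded U → U ⊆ slab L →
      Tendsto (fun n => eLpNorm (fun p => u n p - F p) 2 (volume.restrict U)) atTop (𝓝 0) ∧
      Tendsto (fun n => eLpNorm (fun p => gradient (u n) p - W p) 2 (volume.restrict U))
        atTop (𝓝 0)) ∧
    ∀ c : ℝ, c = 0 ∨ c = L → ∀ r : ℝ,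
      Tendsto (fun n => eLpNorm (fun q : ℝ × ℝ => u n (pt c q.1 q.2) - T (pt c q.1 q.2)) 2
        (volume.restrict (Metric.ball 0 r))) atTop (𝓝 0)

/-- Admissible variations: `F` is in `H¹_loc(D)` with weak gradient `W`, is periodic in `(y, z)`,
and vanishes on the boundary of `D` in the sense of traces. -/
structure AdmissibleVariation (L P₁ P₂ : ℝ) (F : E3 → ℝ) (W : E3 → E3) : Prop where
  weakGrad : HasWeakGrad L F W
  periodic : AEPeriodicYZ L P₁ P₂ F
  trace_zero : HasTrace L F W 0

/-- The symmetric bilinear form `B_{(f,g)}((F, G), (δF, δG))`, where `DF`, `DG`, `DδF`, `DδG` are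
the weak gradients of `F`, `G`, `δF`, `δG`. -/
def secondVariation (L P₁ P₂ : ℝ) (H : ℝ × ℝ → ℝ) (f g : E3 → ℝ)
    (F : E3 → ℝ) (DF : E3 → E3) (G : E3 → ℝ) (DG : E3 → E3)
    (δF : E3 → ℝ) (DδF : E3 → E3) (δG : E3 → ℝ) (DδG : E3 → E3) : ℝ :=
  ∫ p in cell L P₁ P₂,
    (dot (cross (DF p) (grad L g p) + cross (grad L f p) (DG p))
        (cross (DδF p) (grad L g p) + cross (grad L f p) (DδG p))
      + dot (velocity L f g p) (cross (DF p) (DδG p))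
      + dot (velocity L f g p) (cross (DδF p) (DG p))
      + Hff H (f p, g p) * (F p * δF p)
      + Hfg H (f p, g p) * (F p * δG p + G p * δF p)
      + Hgg H (f p, g p) * (G p * δG p))

end SteadyEuler

end

open SteadyEuler

/-!
Write `A = ∇f`, `B = ∇g`, `v = A × B`, `ρ = |v|²`, and for a pair of variations
`Z = ∇F × B + A × ∇G`, `γ = v · ∇F`, `γ' = v · ∇G`, `D = v · Z`. The terms containing `H` are the
same on both sides, so the claim concerns `∫ |Z|² + 2 v · (∇F × ∇G)`.

*Pointwise coercivity.* Since `Z × v = γ B - γ' A`, Lagrange's identity gives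
`ρ |Z|² = D² + |γ B - γ' A|²`. The hypothesis on `(a, b)` says that the eigenvalues of the Gram
matrix of `(a, b)` are at most one; their product is `|a × b|²`, so both are at least `|a × b|²`
(`gram_lower_bound`). For `(A, B)` close to `(a, b)` this yields
`|Z|² ≥ D² / 2 + (31 / 32) (γ² + γ'²)` (`variation_lower_bound`).

*The indefinite term.* The term `v · (∇F × ∇G)` is a null Lagrangian up to derivatives of `v`: with
`w = curl v`, its integral is `∫ F w · ∇G` (`AdmissibleVariation.integral_cell_vcurl`). Neither
`|Z|²` nor `γ, γ'` controls `∇G`, but `|Z|²` controls `D = (B × v) · ∇F + (v × A) · ∇G`. Expanding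
`w = c₁ B × v + c₂ v × A + c₃ v`, replacing `(v × A) · ∇G` by `D - (B × v) · ∇F` and integrating by
parts three times (`AdmissibleVariation.integral_cell_vdiv` with the fields `c₁ B × v`, `c₂ B × v`,
`c₁ v × A`) leaves only a quadratic expression in `F`, `G`, `D`, `γ'`, whose coefficients are
the `cᵢ` and the divergences of the three fields. These involve at most third derivatives of `f` and
`g`, and tend to zero with the `C²` distance of the gradients to `a` and `b`.

*Poincaré inequality.* Completing the square in `(v · ∇F - q F)²`, with `q` linear in `x`, and
integrating by parts bounds `∫ γ²` below by nearly `(s² / L²) ∫ F²`, where `s` is the first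
component of `a × b`. A weight `7 / 8` of it dominates `π² min v₁² / (16 L²)`, because `π² < 14`,
with room to absorb all the small terms, including those controlled by `v'`. The estimate therefore holds with
`C = 0` (`absorb_small_terms`, `secondVariation_ge_of_pointwise`).

*Weak derivatives.* Integration by parts up to the boundary for a variation of zero trace
(`AdmissibleVariation.integral_mul_pd`) follows from the divergence theorem for the smooth
approximations that define the trace. The bilinear identities follow by approximating the second
variation as well. They are first tested against weights of bounded support, and pass to the
periodicity cell through a partition of unity whose periodic translates sum to one
(`integral_box_fold`).

Smallness is expressed through `TendsC1`: families of functions that tend to constants in `C¹` along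
a filter are closed under sums, products and inverses, so no constants need to be tracked.
-/

namespace SteadyEuler

section

/-! ### Partial derivatives on the closed slab -/

/-- The `j`-th coordinate vector of `E3`. -/
noncomputable abbrev coordVec (j : Fin 3) : E3 := EuclideanSpace.single j (1 : ℝ)

/-- The `j`-th partial derivative on the closed slab (one-sided in `x` at the boundary). -/
noncomputable def pd (L : ℝ) (j : Fin 3) (u : E3 → ℝ) (p : E3) : ℝ :=
  fderivWithin ℝ u (closedSlab L) p (coordVec j)

/-- The box `(0, L) × (-R₁, R₁) × (-R₂, R₂)`. -/
def box (L R₁ R₂ : ℝ) : Set E3 :=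
  {p | p 0 ∈ Ioo 0 L ∧ p 1 ∈ Ioo (-R₁) R₁ ∧ p 2 ∈ Ioo (-R₂) R₂}

/-- `u` vanishes on the part of the closed slab outside `{|y| < R₁, |z| < R₂}`. -/
def LateralVanish (L R₁ R₂ : ℝ) (u : E3 → ℝ) : Prop :=
  ∀ p ∈ closedSlab L, (R₁ ≤ |p 1| ∨ R₂ ≤ |p 2|) → u p = 0

lemma isOpen_slab (L : ℝ) : IsOpen (slab L) :=
  isOpen_Ioo.preimage (by fun_prop : Continuous fun p : E3 => p 0)

lemma slab_subset_closedSlab (L : ℝ) : slab L ⊆ closedSlab L :=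
  fun _ hp => Ioo_subset_Icc_self hp

lemma closedSlab_mem_nhds {L : ℝ} {p : E3} (hp : p ∈ slab L) : closedSlab L ∈ 𝓝 p :=
  mem_of_superset ((isOpen_slab L).mem_nhds hp) (slab_subset_closedSlab L)

lemma convex_closedSlab (L : ℝ) : Convex ℝ (closedSlab L) :=
  (convex_Icc (0 : ℝ) L).linear_preimage (EuclideanSpace.proj (0 : Fin 3) : E3 →L[ℝ] ℝ).toLinearMap

lemma uniqueDiffOn_closedSlab {L : ℝ} (hL : 0 < L) : UniqueDiffOn ℝ (closedSlab L) := by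
  apply uniqueDiffOn_convex (convex_closedSlab L)
  refine ⟨pt (L / 2) 0 0, mem_interior_iff_mem_nhds.2 (closedSlab_mem_nhds ?_)⟩
  constructor <;> simp [pt] <;> linarith

lemma isOpen_box (L R₁ R₂ : ℝ) : IsOpen (box L R₁ R₂) := by
  have h (i : Fin 3) : Continuous fun p : E3 => p i := by fun_prop
  exact (isOpen_Ioo.preimage (h 0)).inter
    ((isOpen_Ioo.preimage (h 1)).inter (isOpen_Ioo.preimage (h 2)))

lemma box_subset_slab (L R₁ R₂ : ℝ) : box L R₁ R₂ ⊆ slab L := fun _ hp => hp.1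

lemma isCompact_closedBox (a b : Fin 3 → ℝ) : IsCompact {p : E3 | ∀ i, p i ∈ Icc (a i) (b i)} := by
  have h : IsCompact (Set.pi univ fun i => Icc (a i) (b i)) :=
    isCompact_univ_pi fun i => isCompact_Icc
  have := h.image (PiLp.continuous_toLp 2 (fun _ : Fin 3 => ℝ))
  convert this using 1
  ext p
  constructor
  · intro hp
    exact ⟨p.ofLp, fun i _ => hp i, rfl⟩
  · rintro ⟨q, hq, rfl⟩ i
    exact hq i (mem_univ i)

lemma isBounded_box (L R₁ R₂ : ℝ) : Bornology.IsBounded (box L R₁ R₂) := by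
  refine (isCompact_closedBox ![0, -R₁, -R₂] ![L, R₁, R₂]).isBounded.subset ?_
  rintro p ⟨h0, h1, h2⟩ i
  fin_cases i
  · exact Ioo_subset_Icc_self h0
  · exact Ioo_subset_Icc_self h1
  · exact Ioo_subset_Icc_self h2

variable {L : ℝ} {j : Fin 3} {u w : E3 → ℝ} {p : E3}

lemma diffWithin {S : Set E3} (hu : ContDiffOn ℝ 1 u S) (hp : p ∈ S) :
    DifferentiableWithinAt ℝ u S p :=
  (hu.differentiableOn one_ne_zero) p hp

lemma pd_mul (hL : 0 < L) (hu : ContDiffOn ℝ 1 u (closedSlab L))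
    (hw : ContDiffOn ℝ 1 w (closedSlab L)) (hp : p ∈ closedSlab L) :
    pd L j (fun q => u q * w q) p = u p * pd L j w p + w p * pd L j u p := by
  simp only [pd]
  rw [fderivWithin_fun_mul (uniqueDiffOn_closedSlab hL p hp) (diffWithin hu hp) (diffWithin hw hp)]
  simp

lemma pd_add (hL : 0 < L) (hu : ContDiffOn ℝ 1 u (closedSlab L))
    (hw : ContDiffOn ℝ 1 w (closedSlab L)) (hp : p ∈ closedSlab L) :
    pd L j (fun q => u q + w q) p = pd L j u p + pd L j w p := by
  simp only [pd]
  rw [fderivWithin_fun_add (uniqueDiffOn_closedSlab hL p hp) (diffWithin hu hp) (diffWithin hw hp)]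
  simp

lemma pd_sub (hL : 0 < L) (hu : ContDiffOn ℝ 1 u (closedSlab L))
    (hw : ContDiffOn ℝ 1 w (closedSlab L)) (hp : p ∈ closedSlab L) :
    pd L j (fun q => u q - w q) p = pd L j u p - pd L j w p := by
  simp only [pd]
  rw [fderivWithin_fun_sub (uniqueDiffOn_closedSlab hL p hp) (diffWithin hu hp) (diffWithin hw hp)]
  simp

lemma pd_const (c : ℝ) : pd L j (fun _ => c) p = 0 := by
  simp [pd]

lemma pd_eq_fderiv_of_mem_slab (hp : p ∈ slab L) : pd L j u p = fderiv ℝ u p (coordVec j) := by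
  rw [pd, fderivWithin_of_mem_nhds (closedSlab_mem_nhds hp)]

lemma pd_eq_fderiv (hL : 0 < L) (hu : ContDiff ℝ 1 u) (hp : p ∈ closedSlab L) :
    pd L j u p = fderiv ℝ u p (coordVec j) := by
  rw [pd, fderivWithin_eq_fderiv (uniqueDiffOn_closedSlab hL p hp)]
  exact (hu.differentiable one_ne_zero) p

lemma contDiffOn_pd {n : WithTop ℕ∞} (hL : 0 < L) (hu : ContDiffOn ℝ (n + 1) u (closedSlab L)) :
    ContDiffOn ℝ n (pd L j u) (closedSlab L) :=
  (hu.fderivWithin (uniqueDiffOn_closedSlab hL) le_rfl).clm_apply contDiffOn_const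

lemma continuousOn_pd (hL : 0 < L) (hu : ContDiffOn ℝ 1 u (closedSlab L)) :
    ContinuousOn (pd L j u) (closedSlab L) :=
  (contDiffOn_pd (n := 0) hL (by simpa using hu)).continuousOn

lemma contDiff_fderiv_coord (hu : ContDiff ℝ ∞ u) :
    ContDiff ℝ ∞ (fun q => fderiv ℝ u q (coordVec j)) :=
  (hu.fderiv_right (m := ∞) le_rfl).clm_apply contDiff_const

lemma pd_fderiv_comm (hL : 0 < L) (hu : ContDiff ℝ ∞ u) (j k : Fin 3) (hp : p ∈ closedSlab L) :
    pd L j (fun q => fderiv ℝ u q (coordVec k)) p =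
      pd L k (fun q => fderiv ℝ u q (coordVec j)) p := by
  have h1 (i : Fin 3) : ContDiff ℝ 1 (fun q => fderiv ℝ u q (coordVec i)) :=
    (contDiff_fderiv_coord hu).of_le (by simp)
  rw [pd_eq_fderiv hL (h1 k) hp, pd_eq_fderiv hL (h1 j) hp]
  have hd : DifferentiableAt ℝ (fderiv ℝ u) p :=
    ((hu.fderiv_right (m := ∞) le_rfl).differentiable (by simp)) p
  rw [fderiv_clm_apply hd (by fun_prop), fderiv_clm_apply hd (by fun_prop)]
  have hs : IsSymmSndFDerivAt ℝ u p :=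
    (hu.contDiffAt (x := p)).isSymmSndFDerivAt (by simp; norm_cast)
  simpa using hs (coordVec j) (coordVec k)

lemma gradient_apply (u : E3 → ℝ) (p : E3) (j : Fin 3) :
    gradient u p j = fderiv ℝ u p (coordVec j) := by
  rw [← inner_gradient_left, EuclideanSpace.inner_single_right]
  simp

lemma grad_apply (L : ℝ) (u : E3 → ℝ) (p : E3) (j : Fin 3) :
    grad L u p j = pd L j u p := by
  rw [pd, ← inner_gradientWithin_left, EuclideanSpace.inner_single_right]
  simp [grad]

/-! ### The divergence theorem on a box -/

lemma box_eq_preimage (L R₁ R₂ : ℝ) :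
    (WithLp.toLp 2 : (Fin 3 → ℝ) → E3) ⁻¹' box L R₁ R₂ =
      Set.pi univ fun i => Ioo ((![0, -R₁, -R₂] : Fin 3 → ℝ) i) ((![L, R₁, R₂] : Fin 3 → ℝ) i) := by
  ext x
  simp [box, Set.mem_pi, Fin.forall_fin_succ]

lemma integral_box_eq (L R₁ R₂ : ℝ) (K : E3 → ℝ) :
    ∫ p in box L R₁ R₂, K p =
      ∫ x in Icc (![0, -R₁, -R₂] : Fin 3 → ℝ) ![L, R₁, R₂], K (WithLp.toLp 2 x) := by
  rw [← (PiLp.volume_preserving_toLp (Fin 3)).setIntegral_preimage_emb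
    (MeasurableEquiv.toLp 2 (Fin 3 → ℝ)).measurableEmbedding, box_eq_preimage]
  exact setIntegral_congr_set Measure.univ_pi_Ioo_ae_eq_Icc

lemma hasFDerivAt_comp_toLp {x : Fin 3 → ℝ} (hu : ContDiffOn ℝ 1 u (closedSlab L))
    (hx : (WithLp.toLp 2 x : E3) ∈ slab L) :
    HasFDerivAt (fun y : Fin 3 → ℝ => u (WithLp.toLp 2 y))
      ((fderivWithin ℝ u (closedSlab L) (WithLp.toLp 2 x)).comp
        (PiLp.continuousLinearEquiv 2 ℝ (fun _ : Fin 3 => ℝ)).symm.toContinuousLinearMap) x := by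
  have h1 : HasFDerivAt u (fderivWithin ℝ u (closedSlab L) (WithLp.toLp 2 x)) (WithLp.toLp 2 x) :=
    ((diffWithin hu (slab_subset_closedSlab L hx)).hasFDerivWithinAt).hasFDerivAt
      (closedSlab_mem_nhds hx)
  exact HasFDerivAt.comp x h1
    (PiLp.continuousLinearEquiv 2 ℝ (fun _ : Fin 3 => ℝ)).symm.toContinuousLinearMap.hasFDerivAt

/-- Fubini and the fundamental theorem of calculus in one coordinate direction, as a special case
of the divergence theorem. -/
lemma integral_pd_box_eq_faces {R₁ R₂ : ℝ} (hL : 0 < L) (hR₁ : 0 < R₁) (hR₂ : 0 < R₂)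
    (hu : ContDiffOn ℝ 1 u (closedSlab L)) (j : Fin 3) :
    ∫ p in box L R₁ R₂, pd L j u p =
      (∫ x in Icc ((![0, -R₁, -R₂] : Fin 3 → ℝ) ∘ j.succAbove)
          ((![L, R₁, R₂] : Fin 3 → ℝ) ∘ j.succAbove),
        u (WithLp.toLp 2 (j.insertNth ((![L, R₁, R₂] : Fin 3 → ℝ) j) x))) -
      ∫ x in Icc ((![0, -R₁, -R₂] : Fin 3 → ℝ) ∘ j.succAbove)
          ((![L, R₁, R₂] : Fin 3 → ℝ) ∘ j.succAbove),
        u (WithLp.toLp 2 (j.insertNth ((![0, -R₁, -R₂] : Fin 3 → ℝ) j) x)) := by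
  set a : Fin 3 → ℝ := ![0, -R₁, -R₂] with ha
  set b : Fin 3 → ℝ := ![L, R₁, R₂] with hb
  have hle : a ≤ b := by
    intro i
    fin_cases i <;> simp [ha, hb] <;> linarith
  have hmaps : MapsTo (WithLp.toLp 2 : (Fin 3 → ℝ) → E3) (Icc a b) (closedSlab L) := by
    intro x hx
    exact ⟨by simpa [ha] using hx.1 0, by simpa [hb] using hx.2 0⟩
  have hcont : Continuous (WithLp.toLp 2 : (Fin 3 → ℝ) → E3) := PiLp.continuous_toLp 2 _
  have key := integral_divergence_of_hasFDerivAt_off_countable' a b hle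
    (fun i x => if i = j then u (WithLp.toLp 2 x) else 0)
    (fun i x => if i = j then ((fderivWithin ℝ u (closedSlab L) (WithLp.toLp 2 x)).comp
        (PiLp.continuousLinearEquiv 2 ℝ (fun _ : Fin 3 => ℝ)).symm.toContinuousLinearMap) else 0)
    ∅ countable_empty
    (by
      intro i
      by_cases hij : i = j
      · simp only [hij, if_true]
        exact hu.continuousOn.comp hcont.continuousOn hmaps
      · simp only [hij, if_false]
        exact continuousOn_const)
    (by
      intro x hx i
      by_cases hij : i = j
      · simp only [hij, if_true]
        refine hasFDerivAt_comp_toLp hu ?_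
        have := hx.1 0 (mem_univ _)
        simpa [ha, hb, slab] using this
      · simp only [hij, if_false]
        exact hasFDerivAt_const _ _)
    (by
      have h1 : ContinuousOn (fun x : Fin 3 → ℝ => pd L j u (WithLp.toLp 2 x)) (Icc a b) :=
        (continuousOn_pd hL hu).comp hcont.continuousOn hmaps
      refine (h1.integrableOn_compact isCompact_Icc).congr_fun ?_ measurableSet_Icc
      intro x _
      simp only
      rw [Finset.sum_eq_single j (by intro i _ hij; simp [hij]) (by simp)]
      simp [pd])
  rw [integral_box_eq]
  rw [Finset.sum_eq_single (M := ℝ) j (by intro i _ hij; simp [hij]) (by simp)] at key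
  simp only [if_true] at key
  rw [← key]
  refine setIntegral_congr_fun measurableSet_Icc ?_
  intro x _
  simp only
  rw [Finset.sum_eq_single j (by intro i _ hij; simp [hij]) (by simp)]
  simp [pd]

lemma integral_pd_lateral {R₁ R₂ : ℝ} (hL : 0 < L) (hR₁ : 0 < R₁) (hR₂ : 0 < R₂)
    (hu : ContDiffOn ℝ 1 u (closedSlab L)) (hv : LateralVanish L R₁ R₂ u) (hj : j ≠ 0) :
    ∫ p in box L R₁ R₂, pd L j u p = 0 := by
  rw [integral_pd_box_eq_faces hL hR₁ hR₂ hu]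
  have hz : ∀ x ∈ Icc ((![0, -R₁, -R₂] : Fin 3 → ℝ) ∘ j.succAbove)
      ((![L, R₁, R₂] : Fin 3 → ℝ) ∘ j.succAbove), ∀ c : ℝ,
      (c = (![L, R₁, R₂] : Fin 3 → ℝ) j ∨ c = (![0, -R₁, -R₂] : Fin 3 → ℝ) j) →
      u (WithLp.toLp 2 (j.insertNth c x)) = 0 := by
    intro x hx c hc
    apply hv
    · have h0 := hx.1 0
      have h1 := hx.2 0
      fin_cases j
      · exact absurd rfl hj
      · simp [Fin.succAbove] at h0 h1
        constructor <;> simpa [Fin.insertNth_apply_below, Fin.insertNth, Fin.succAboveCases]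
      · simp [Fin.succAbove] at h0 h1
        constructor <;> simpa [Fin.insertNth, Fin.succAboveCases]
    · fin_cases j
      · exact absurd rfl hj
      · left
        rcases hc with rfl | rfl <;> simp [Fin.insertNth, Fin.succAboveCases, abs_of_pos hR₁]
      · right
        rcases hc with rfl | rfl <;> simp [Fin.insertNth, Fin.succAboveCases, abs_of_pos hR₂]
  rw [setIntegral_congr_fun (g := fun _ => 0) measurableSet_Icc
      (fun x hx => hz x hx _ (Or.inl rfl)),
    setIntegral_congr_fun (g := fun _ => 0) measurableSet_Icc
      (fun x hx => hz x hx _ (Or.inr rfl))]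
  simp

lemma integral_face_zero (R₁ R₂ c : ℝ) (K : E3 → ℝ) :
    ∫ x in Icc ((![0, -R₁, -R₂] : Fin 3 → ℝ) ∘ (0 : Fin 3).succAbove)
      ((![L, R₁, R₂] : Fin 3 → ℝ) ∘ (0 : Fin 3).succAbove),
      K (WithLp.toLp 2 ((0 : Fin 3).insertNth (α := fun _ => ℝ) c x)) =
    ∫ q in Icc (-R₁) R₁ ×ˢ Icc (-R₂) R₂, K (pt c q.1 q.2) := by
  rw [← (volume_preserving_finTwoArrow ℝ).setIntegral_preimage_emb
    (MeasurableEquiv.finTwoArrow).measurableEmbedding]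
  have : (MeasurableEquiv.finTwoArrow : (Fin 2 → ℝ) ≃ᵐ ℝ × ℝ) ⁻¹'
      (Icc (-R₁) R₁ ×ˢ Icc (-R₂) R₂) = Icc ((![0, -R₁, -R₂] : Fin 3 → ℝ) ∘ (0 : Fin 3).succAbove)
      ((![L, R₁, R₂] : Fin 3 → ℝ) ∘ (0 : Fin 3).succAbove) := by
    ext x
    simp [Pi.le_def, Fin.forall_fin_two, MeasurableEquiv.finTwoArrow]
  rw [this]
  refine setIntegral_congr_fun measurableSet_Icc ?_
  intro x _
  simp only
  congr 1
  ext i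
  fin_cases i <;> simp [pt, MeasurableEquiv.finTwoArrow]
  rfl

lemma integral_pd_normal {R₁ R₂ : ℝ} (hL : 0 < L) (hR₁ : 0 < R₁) (hR₂ : 0 < R₂)
    (hu : ContDiffOn ℝ 1 u (closedSlab L)) :
    ∫ p in box L R₁ R₂, pd L 0 u p =
      (∫ q in Icc (-R₁) R₁ ×ˢ Icc (-R₂) R₂, u (pt L q.1 q.2)) -
        ∫ q in Icc (-R₁) R₁ ×ˢ Icc (-R₂) R₂, u (pt 0 q.1 q.2) := by
  rw [integral_pd_box_eq_faces hL hR₁ hR₂ hu, integral_face_zero, integral_face_zero]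
  rfl

end

section

/-! ### Integration by parts for variations -/

lemma integrable_mul_of_L2 {α : Type*} [MeasurableSpace α] {μ : Measure α} {Φ G : α → ℝ}
    (hΦ : MemLp Φ 2 μ) (hG : MemLp G 2 μ) : Integrable (fun x => Φ x * G x) μ :=
  hΦ.integrable_mul hG

lemma tendsto_integral_mul_of_L2 {α : Type*} [MeasurableSpace α] {μ : Measure α}
    {Φ G : α → ℝ} {h : ℕ → α → ℝ} (hΦ : MemLp Φ 2 μ) (hG : MemLp G 2 μ)
    (hh : ∀ n, MemLp (h n) 2 μ)
    (hlim : Tendsto (fun n => eLpNorm (fun x => h n x - G x) 2 μ) atTop (𝓝 0)) :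
    Tendsto (fun n => ∫ x, Φ x * h n x ∂μ) atTop (𝓝 (∫ x, Φ x * G x ∂μ)) := by
  refine tendsto_integral_of_L1' _ (hΦ.integrable_mul hG).aestronglyMeasurable
    (Eventually.of_forall fun n => hΦ.integrable_mul (hh n)) ?_
  have hb : ∀ n, eLpNorm ((fun x => Φ x * h n x) - fun x => Φ x * G x) 1 μ ≤
      eLpNorm Φ 2 μ * eLpNorm (fun x => h n x - G x) 2 μ := by
    intro n
    have := eLpNorm_smul_le_mul_eLpNorm (p := 2) (q := 2) (r := 1)
      (((hh n).sub hG).aestronglyMeasurable) hΦ.aestronglyMeasurable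
    refine le_trans (le_of_eq ?_) this
    congr 1
    ext x
    simp [mul_sub]
  refine tendsto_of_tendsto_of_tendsto_of_le_of_le tendsto_const_nhds ?_ (fun _ => zero_le) hb
  have := ENNReal.Tendsto.const_mul (a := eLpNorm Φ 2 μ) hlim (Or.inr hΦ.eLpNorm_ne_top)
  simpa using this

lemma exists_bound_box {L : ℝ} (R₁ R₂ : ℝ) {κ : E3 → ℝ} (hκ : ContinuousOn κ (closedSlab L)) :
    ∃ C, ∀ p ∈ box L R₁ R₂, ‖κ p‖ ≤ C := by
  have hK := isCompact_closedBox ![0, -R₁, -R₂] ![L, R₁, R₂]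
  obtain ⟨C, hC⟩ := hK.exists_bound_of_continuousOn (hκ.mono fun p hp => hp 0)
  refine ⟨C, fun p hp => hC p fun i => ?_⟩
  obtain ⟨h0, h1, h2⟩ := hp
  fin_cases i
  · exact Ioo_subset_Icc_self h0
  · exact Ioo_subset_Icc_self h1
  · exact Ioo_subset_Icc_self h2

/-- Multiplication by a function continuous on the closed slab preserves `L²` of a box. -/
lemma memLp_mul_of_continuousOn {L R₁ R₂ : ℝ} {κ F : E3 → ℝ} (hκ : ContinuousOn κ (closedSlab L))
    (hF : MemLp F 2 (volume.restrict (box L R₁ R₂))) :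
    MemLp (fun p => κ p * F p) 2 (volume.restrict (box L R₁ R₂)) := by
  obtain ⟨C, hC⟩ := exists_bound_box R₁ R₂ hκ
  have hm : AEStronglyMeasurable κ (volume.restrict (box L R₁ R₂)) :=
    (hκ.mono ((box_subset_slab L R₁ R₂).trans (slab_subset_closedSlab L))).aestronglyMeasurable
      (isOpen_box L R₁ R₂).measurableSet
  refine hF.of_le_mul (c := C) (hm.mul hF.aestronglyMeasurable) ?_
  filter_upwards [ae_restrict_mem (isOpen_box L R₁ R₂).measurableSet] with p hp
  rw [norm_mul]
  gcongr
  exact hC p hp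

lemma isFiniteMeasure_box (L R₁ R₂ : ℝ) : IsFiniteMeasure (volume.restrict (box L R₁ R₂)) :=
  ⟨by simpa using (isBounded_box L R₁ R₂).measure_lt_top⟩

lemma memLp_of_continuousOn {L R₁ R₂ : ℝ} {κ : E3 → ℝ} (hκ : ContinuousOn κ (closedSlab L)) :
    MemLp κ 2 (volume.restrict (box L R₁ R₂)) := by
  have := isFiniteMeasure_box L R₁ R₂
  simpa using memLp_mul_of_continuousOn (R₁ := R₁) (R₂ := R₂) hκ (memLp_const (1 : ℝ))

variable {L P₁ P₂ R₁ R₂ : ℝ} {F G : E3 → ℝ} {DF DG : E3 → E3} {κ : E3 → ℝ}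

lemma AdmissibleVariation.memLp_box (hF : AdmissibleVariation L P₁ P₂ F DF) (R₁ R₂ : ℝ) :
    MemLp F 2 (volume.restrict (box L R₁ R₂)) :=
  hF.weakGrad.memLp _ (isOpen_box L R₁ R₂) (isBounded_box L R₁ R₂) (box_subset_slab L R₁ R₂)

lemma memLp_coord {U : Set E3} (hW : MemLp DF 2 (volume.restrict U)) (j : Fin 3) :
    MemLp (fun p => DF p j) 2 (volume.restrict U) := by
  refine hW.of_le ?_ (Eventually.of_forall fun p => PiLp.norm_apply_le (DF p) j)
  exact (by fun_prop : Continuous fun q : E3 => q j).comp_aestronglyMeasurable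
    hW.aestronglyMeasurable

lemma AdmissibleVariation.memLp_grad_box (hF : AdmissibleVariation L P₁ P₂ F DF) (R₁ R₂ : ℝ)
    (j : Fin 3) : MemLp (fun p => DF p j) 2 (volume.restrict (box L R₁ R₂)) :=
  memLp_coord (hF.weakGrad.memLp_grad _ (isOpen_box L R₁ R₂) (isBounded_box L R₁ R₂)
    (box_subset_slab L R₁ R₂)) j

lemma tendsto_coord_gradient {U : Set E3} {u : ℕ → E3 → ℝ}
    (h : Tendsto (fun n => eLpNorm (fun p => gradient (u n) p - DF p) 2 (volume.restrict U))
      atTop (𝓝 0)) (j : Fin 3) :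
    Tendsto (fun n => eLpNorm (fun p => fderiv ℝ (u n) p (coordVec j) - DF p j) 2
      (volume.restrict U)) atTop (𝓝 0) := by
  refine tendsto_of_tendsto_of_tendsto_of_le_of_le tendsto_const_nhds h (fun _ => zero_le) ?_
  intro n
  refine eLpNorm_mono fun p => ?_
  rw [← gradient_apply]
  exact PiLp.norm_apply_le (gradient (u n) p - DF p) j

lemma continuous_pt (c : ℝ) : Continuous fun q : ℝ × ℝ => pt c q.1 q.2 := by
  unfold pt
  refine (PiLp.continuous_toLp 2 (fun _ : Fin 3 => ℝ)).comp ?_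
  refine continuous_pi fun i => ?_
  fin_cases i
  · exact continuous_const
  · exact continuous_fst
  · exact continuous_snd

/-- The contribution of a boundary component to the divergence theorem tends to zero along
functions whose boundary values tend to zero. -/
lemma tendsto_face {c : ℝ} (hc : c ∈ Icc 0 L) {u : ℕ → E3 → ℝ} (hu : ∀ n, ContDiff ℝ ∞ (u n))
    (ht : ∀ r : ℝ, Tendsto (fun n => eLpNorm (fun q : ℝ × ℝ => u n (pt c q.1 q.2)) 2
        (volume.restrict (Metric.ball 0 r))) atTop (𝓝 0))
    (hκ : ContinuousOn κ (closedSlab L)) :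
    Tendsto (fun n => ∫ q in Icc (-R₁) R₁ ×ˢ Icc (-R₂) R₂, κ (pt c q.1 q.2) * u n (pt c q.1 q.2))
      atTop (𝓝 0) := by
  have hK : IsCompact (Icc (-R₁) R₁ ×ˢ Icc (-R₂) R₂) := isCompact_Icc.prod isCompact_Icc
  obtain ⟨r, hr⟩ := hK.isBounded.subset_ball (0 : ℝ × ℝ)
  have hfin : IsFiniteMeasure (volume.restrict (Icc (-R₁) R₁ ×ˢ Icc (-R₂) R₂)) :=
    ⟨by simpa using hK.measure_lt_top⟩
  have hmem {f : ℝ × ℝ → ℝ} (hf : Continuous f) :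
      MemLp f 2 (volume.restrict (Icc (-R₁) R₁ ×ˢ Icc (-R₂) R₂)) := by
    obtain ⟨C, hC⟩ := hK.exists_bound_of_continuousOn hf.continuousOn
    exact MemLp.of_bound hf.aestronglyMeasurable C
      ((ae_restrict_mem hK.measurableSet).mono fun q hq => hC q hq)
  have h := tendsto_integral_mul_of_L2 (μ := volume.restrict (Icc (-R₁) R₁ ×ˢ Icc (-R₂) R₂))
    (Φ := fun q : ℝ × ℝ => κ (pt c q.1 q.2)) (G := fun _ => 0)
    (h := fun n q => u n (pt c q.1 q.2)) (hmem ?_) (hmem continuous_const)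
    (fun n => hmem ((hu n).continuous.comp (continuous_pt c))) ?_
  · simpa using h
  · exact hκ.comp_continuous (continuous_pt c) fun q => by simpa [closedSlab, pt] using hc
  · refine tendsto_of_tendsto_of_tendsto_of_le_of_le tendsto_const_nhds (ht r)
      (fun _ => zero_le) fun n => ?_
    simp only [sub_zero]
    exact eLpNorm_mono_measure _ (Measure.restrict_mono hr le_rfl)

/-- Integration by parts against a function of class `C¹` up to the boundary: the boundary terms
at `x = 0` and `x = L` vanish because `F` has zero trace. -/
lemma AdmissibleVariation.integral_mul_pd (hL : 0 < L) (hR₁ : 0 < R₁) (hR₂ : 0 < R₂)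
    (hF : AdmissibleVariation L P₁ P₂ F DF) (hκ : ContDiffOn ℝ 1 κ (closedSlab L))
    (hv : LateralVanish L R₁ R₂ κ) (j : Fin 3) :
    (∫ p in box L R₁ R₂, pd L j κ p * F p) + ∫ p in box L R₁ R₂, κ p * DF p j = 0 := by
  obtain ⟨u, hu, hconv, htr⟩ := hF.trace_zero
  obtain ⟨hc1, hc2⟩ := hconv _ (isOpen_box L R₁ R₂) (isBounded_box L R₁ R₂)
    (box_subset_slab L R₁ R₂)
  have hc2 := tendsto_coord_gradient hc2 j
  have hu1 (n : ℕ) : ContDiff ℝ 1 (u n) := (hu n).of_le (by simp)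
  have hdu (n : ℕ) : Continuous fun p => fderiv ℝ (u n) p (coordVec j) :=
    (contDiff_fderiv_coord (hu n)).continuous
  have t1 := tendsto_integral_mul_of_L2
    (memLp_of_continuousOn (R₁ := R₁) (R₂ := R₂) (continuousOn_pd (j := j) hL hκ))
    (hF.memLp_box R₁ R₂) (fun n => memLp_of_continuousOn (hu n).continuous.continuousOn) hc1
  have t2 := tendsto_integral_mul_of_L2
    (memLp_of_continuousOn (R₁ := R₁) (R₂ := R₂) hκ.continuousOn)
    (hF.memLp_grad_box R₁ R₂ j) (fun n => memLp_of_continuousOn (hdu n).continuousOn) hc2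
  refine tendsto_nhds_unique (t1.add t2) ?_
  have hsum (n : ℕ) : (∫ p in box L R₁ R₂, pd L j κ p * u n p) +
      (∫ p in box L R₁ R₂, κ p * fderiv ℝ (u n) p (coordVec j)) =
      ∫ p in box L R₁ R₂, pd L j (fun q => κ q * u n q) p := by
    rw [← integral_add]
    · refine setIntegral_congr_fun (isOpen_box L R₁ R₂).measurableSet fun p hp => ?_
      have hp' := slab_subset_closedSlab L (box_subset_slab L R₁ R₂ hp)
      rw [pd_mul hL hκ (hu1 n).contDiffOn hp', pd_eq_fderiv hL (hu1 n) hp']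
      ring
    · exact (memLp_of_continuousOn (continuousOn_pd hL hκ)).integrable_mul
        (memLp_of_continuousOn (hu n).continuous.continuousOn)
    · exact (memLp_of_continuousOn hκ.continuousOn).integrable_mul
        (memLp_of_continuousOn (hdu n).continuousOn)
  have hC (n : ℕ) : ContDiffOn ℝ 1 (fun q => κ q * u n q) (closedSlab L) :=
    hκ.mul (hu1 n).contDiffOn
  simp only [hsum]
  by_cases hj : j = 0
  · subst hj
    simp only [fun n => integral_pd_normal (R₁ := R₁) (R₂ := R₂) hL hR₁ hR₂ (hC n)]
    have f1 := tendsto_face (R₁ := R₁) (R₂ := R₂) (right_mem_Icc.2 hL.le) hu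
      (by simpa using htr L (Or.inr rfl)) hκ.continuousOn
    have f2 := tendsto_face (R₁ := R₁) (R₂ := R₂) (left_mem_Icc.2 hL.le) hu
      (by simpa using htr 0 (Or.inl rfl)) hκ.continuousOn
    simpa using f1.sub f2
  · have hz (n : ℕ) : ∫ p in box L R₁ R₂, pd L j (fun q => κ q * u n q) p = 0 :=
      integral_pd_lateral hL hR₁ hR₂ (hC n) (fun p hp h => by simp [hv p hp h]) hj
    simp [hz]

/-- The product rule for two variations, tested against a `C¹` weight. -/
lemma AdmissibleVariation.integral_product_rule (hL : 0 < L) (hR₁ : 0 < R₁) (hR₂ : 0 < R₂)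
    (hF : AdmissibleVariation L P₁ P₂ F DF) (hG : AdmissibleVariation L P₁ P₂ G DG)
    (hκ : ContDiffOn ℝ 1 κ (closedSlab L)) (hv : LateralVanish L R₁ R₂ κ) (j : Fin 3) :
    (∫ p in box L R₁ R₂, pd L j κ p * F p * G p) +
      ((∫ p in box L R₁ R₂, κ p * F p * DG p j) + ∫ p in box L R₁ R₂, κ p * DF p j * G p) = 0 := by
  obtain ⟨h, hh, hconv, -⟩ := hG.trace_zero
  obtain ⟨hc1, hc2⟩ := hconv _ (isOpen_box L R₁ R₂) (isBounded_box L R₁ R₂)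
    (box_subset_slab L R₁ R₂)
  have hc2 := tendsto_coord_gradient hc2 j
  have hh1 (n : ℕ) : ContDiff ℝ 1 (h n) := (hh n).of_le (by simp)
  have hdh (n : ℕ) : Continuous fun p => fderiv ℝ (h n) p (coordVec j) :=
    (contDiff_fderiv_coord (hh n)).continuous
  have hmF := hF.memLp_box R₁ R₂
  have m1 := memLp_mul_of_continuousOn (continuousOn_pd (j := j) hL hκ) hmF
  have m2 := memLp_mul_of_continuousOn hκ.continuousOn hmF
  have m3 := memLp_mul_of_continuousOn hκ.continuousOn (hF.memLp_grad_box R₁ R₂ j)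
  have mh (n : ℕ) : MemLp (h n) 2 (volume.restrict (box L R₁ R₂)) :=
    memLp_of_continuousOn (hh n).continuous.continuousOn
  have mdh (n : ℕ) : MemLp (fun p => fderiv ℝ (h n) p (coordVec j)) 2
      (volume.restrict (box L R₁ R₂)) := memLp_of_continuousOn (hdh n).continuousOn
  have t1 := tendsto_integral_mul_of_L2 m1 (hG.memLp_box R₁ R₂) mh hc1
  have t2 := tendsto_integral_mul_of_L2 m2 (hG.memLp_grad_box R₁ R₂ j) mdh hc2
  have t3 := tendsto_integral_mul_of_L2 m3 (hG.memLp_box R₁ R₂) mh hc1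
  refine tendsto_nhds_unique (t1.add (t2.add t3)) ?_
  refine tendsto_const_nhds.congr fun n => ?_
  have hC : ContDiffOn ℝ 1 (fun q => κ q * h n q) (closedSlab L) := hκ.mul (hh1 n).contDiffOn
  rw [← hF.integral_mul_pd hL hR₁ hR₂ hC (fun p hp h => by simp [hv p hp h]) j, ← add_assoc,
    ← integral_add (integrable_mul_of_L2 m1 (mh n)) (integrable_mul_of_L2 m2 (mdh n))]
  congr 1
  · refine setIntegral_congr_fun (isOpen_box L R₁ R₂).measurableSet fun p hp => ?_
    have hp' := slab_subset_closedSlab L (box_subset_slab L R₁ R₂ hp)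
    rw [pd_mul hL hκ (hh1 n).contDiffOn hp', pd_eq_fderiv hL (hh1 n) hp']
    ring
  · refine setIntegral_congr_fun (isOpen_box L R₁ R₂).measurableSet fun p _ => ?_
    simp only
    ring

/-- The minors of the pair of gradients are null Lagrangians: tested against a `C¹` weight, they
only involve the derivatives of the weight. -/
lemma AdmissibleVariation.integral_minor (hL : 0 < L) (hR₁ : 0 < R₁) (hR₂ : 0 < R₂)
    (hF : AdmissibleVariation L P₁ P₂ F DF) (hG : AdmissibleVariation L P₁ P₂ G DG)
    (hκ : ContDiffOn ℝ 1 κ (closedSlab L)) (hv : LateralVanish L R₁ R₂ κ) (j k : Fin 3) :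
    ((∫ p in box L R₁ R₂, κ p * DF p j * DG p k) + ∫ p in box L R₁ R₂, pd L j κ p * F p * DG p k) -
      ((∫ p in box L R₁ R₂, κ p * DF p k * DG p j) +
        ∫ p in box L R₁ R₂, pd L k κ p * F p * DG p j) = 0 := by
  obtain ⟨h, hh, hconv, -⟩ := hG.trace_zero
  obtain ⟨-, hc2⟩ := hconv _ (isOpen_box L R₁ R₂) (isBounded_box L R₁ R₂)
    (box_subset_slab L R₁ R₂)
  have hdh (n : ℕ) (i : Fin 3) : ContDiff ℝ ∞ fun p => fderiv ℝ (h n) p (coordVec i) :=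
    contDiff_fderiv_coord (hh n)
  have hdh1 (n : ℕ) (i : Fin 3) : ContDiff ℝ 1 fun p => fderiv ℝ (h n) p (coordVec i) :=
    (hdh n i).of_le (by simp)
  have hmF := hF.memLp_box R₁ R₂
  have mdh (n : ℕ) (i : Fin 3) : MemLp (fun p => fderiv ℝ (h n) p (coordVec i)) 2
      (volume.restrict (box L R₁ R₂)) := memLp_of_continuousOn (hdh n i).continuous.continuousOn
  have m1 (i : Fin 3) := memLp_mul_of_continuousOn hκ.continuousOn (hF.memLp_grad_box R₁ R₂ i)
  have m2 (i : Fin 3) := memLp_mul_of_continuousOn (continuousOn_pd (j := i) hL hκ) hmF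
  have t1 (i l : Fin 3) := tendsto_integral_mul_of_L2 (m1 i) (hG.memLp_grad_box R₁ R₂ l)
    (fun n => mdh n l) (tendsto_coord_gradient hc2 l)
  have t2 (i l : Fin 3) := tendsto_integral_mul_of_L2 (m2 i) (hG.memLp_grad_box R₁ R₂ l)
    (fun n => mdh n l) (tendsto_coord_gradient hc2 l)
  refine tendsto_nhds_unique (((t1 j k).add (t2 j k)).sub ((t1 k j).add (t2 k j))) ?_
  refine tendsto_const_nhds.congr fun n => ?_
  -- Both groups equal minus the integral of `F κ ∂ⱼ∂ₖ h`, since second derivatives commute.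
  have hII (i l : Fin 3) : (∫ p in box L R₁ R₂, κ p * DF p i * fderiv ℝ (h n) p (coordVec l)) +
      (∫ p in box L R₁ R₂, pd L i κ p * F p * fderiv ℝ (h n) p (coordVec l)) =
      - ∫ p in box L R₁ R₂, κ p * F p * pd L i (fun q => fderiv ℝ (h n) q (coordVec l)) p := by
    have hC : ContDiffOn ℝ 1 (fun q => κ q * fderiv ℝ (h n) q (coordVec l)) (closedSlab L) :=
      hκ.mul (hdh1 n l).contDiffOn
    have := hF.integral_mul_pd hL hR₁ hR₂ hC (fun p hp h => by simp [hv p hp h]) i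
    have e1 : ∫ p in box L R₁ R₂, pd L i (fun q => κ q * fderiv ℝ (h n) q (coordVec l)) p * F p =
        (∫ p in box L R₁ R₂, pd L i κ p * F p * fderiv ℝ (h n) p (coordVec l)) +
        ∫ p in box L R₁ R₂, κ p * F p * pd L i (fun q => fderiv ℝ (h n) q (coordVec l)) p := by
      rw [← integral_add (integrable_mul_of_L2 (m2 i) (mdh n l))
        (integrable_mul_of_L2 (memLp_mul_of_continuousOn hκ.continuousOn hmF)
          (memLp_of_continuousOn (continuousOn_pd hL (hdh1 n l).contDiffOn)))]
      refine setIntegral_congr_fun (isOpen_box L R₁ R₂).measurableSet fun p hp => ?_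
      have hp' := slab_subset_closedSlab L (box_subset_slab L R₁ R₂ hp)
      rw [pd_mul hL hκ (hdh1 n l).contDiffOn hp']
      ring
    have e2 : ∫ p in box L R₁ R₂, κ p * fderiv ℝ (h n) p (coordVec l) * DF p i =
        ∫ p in box L R₁ R₂, κ p * DF p i * fderiv ℝ (h n) p (coordVec l) := by
      congr 1
      ext p
      ring
    rw [e1, e2] at this
    linarith
  rw [hII, hII]
  have : ∫ p in box L R₁ R₂, κ p * F p * pd L j (fun q => fderiv ℝ (h n) q (coordVec k)) p =
      ∫ p in box L R₁ R₂, κ p * F p * pd L k (fun q => fderiv ℝ (h n) q (coordVec j)) p := by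
    refine setIntegral_congr_fun (isOpen_box L R₁ R₂).measurableSet fun p hp => ?_
    have hp' := slab_subset_closedSlab L (box_subset_slab L R₁ R₂ hp)
    rw [pd_fderiv_comm hL (hh n) j k hp']
  rw [this]
  ring

end

section

open scoped Pointwise

/-! ### Periodic functions and periodic partitions of unity -/

variable {L P₁ P₂ : ℝ}

lemma volume_hyperplane (i : Fin 3) (c : ℝ) : volume {p : E3 | p i = c} = 0 := by
  have hm : MeasurableSet {p : E3 | p i = c} :=
    (isClosed_eq (by fun_prop : Continuous fun p : E3 => p i) continuous_const).measurableSet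
  rw [← (PiLp.volume_preserving_toLp (Fin 3)).measure_preimage hm.nullMeasurableSet]
  exact Measure.pi_hyperplane (fun _ : Fin 3 => (volume : Measure ℝ)) i c

lemma add_mem_slab_iff {e : E3} (he : e 0 = 0) {p : E3} : p + e ∈ slab L ↔ p ∈ slab L := by
  simp [slab, he]

lemma add_mem_closedSlab_iff {e : E3} (he : e 0 = 0) {p : E3} :
    p + e ∈ closedSlab L ↔ p ∈ closedSlab L := by
  simp [closedSlab, he]

/-- `K` is invariant under translation by `e` almost everywhere on the slab. -/
def AEInvariant {α : Type*} (L : ℝ) (e : E3) (K : E3 → α) : Prop :=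
  ∀ᵐ p ∂(volume.restrict (slab L)), K (p + e) = K p

lemma AEPeriodicYZ.fst {α : Type*} {K : E3 → α} (h : AEPeriodicYZ L P₁ P₂ K) :
    AEInvariant L (pt 0 P₁ 0) K := h.mono fun _ hp => hp.1

lemma AEPeriodicYZ.snd {α : Type*} {K : E3 → α} (h : AEPeriodicYZ L P₁ P₂ K) :
    AEInvariant L (pt 0 0 P₂) K := h.mono fun _ hp => hp.2

lemma PeriodicYZ.ae {α : Type*} {K : E3 → α} (h : PeriodicYZ L P₁ P₂ K) :
    AEPeriodicYZ L P₁ P₂ K :=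
  (ae_restrict_mem (isOpen_slab L).measurableSet).mono fun p hp =>
    h p (slab_subset_closedSlab L hp)

lemma AEPeriodicYZ.map₂ {α β γ : Type*} {K : E3 → α} {M : E3 → β} (Φ : α → β → γ)
    (hK : AEPeriodicYZ L P₁ P₂ K) (hM : AEPeriodicYZ L P₁ P₂ M) :
    AEPeriodicYZ L P₁ P₂ fun p => Φ (K p) (M p) := by
  filter_upwards [hK, hM] with p h1 h2
  exact ⟨by rw [h1.1, h2.1], by rw [h1.2, h2.2]⟩

lemma PeriodicYZ.map₂ {α β γ : Type*} {K : E3 → α} {M : E3 → β} (Φ : α → β → γ)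
    (hK : PeriodicYZ L P₁ P₂ K) (hM : PeriodicYZ L P₁ P₂ M) :
    PeriodicYZ L P₁ P₂ fun p => Φ (K p) (M p) := fun p hp =>
  ⟨congrArg₂ Φ (hK p hp).1 (hM p hp).1, congrArg₂ Φ (hK p hp).2 (hM p hp).2⟩

lemma PeriodicYZ.map {α β : Type*} {K : E3 → α} (Φ : α → β) (hK : PeriodicYZ L P₁ P₂ K) :
    PeriodicYZ L P₁ P₂ fun p => Φ (K p) := hK.map₂ (fun a _ => Φ a) hK

/-- Derivatives within the closed slab of a function invariant under a translation along the slab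
are invariant as well. -/
lemma fderivWithin_closedSlab_invariant {V : Type*} [NormedAddCommGroup V] [NormedSpace ℝ V]
    {e : E3} (he : e 0 = 0) {u : E3 → V} (hu : ∀ p ∈ closedSlab L, u (p + e) = u p)
    {p : E3} (hp : p ∈ closedSlab L) :
    fderivWithin ℝ u (closedSlab L) (p + e) = fderivWithin ℝ u (closedSlab L) p := by
  have hS : e +ᵥ closedSlab L = closedSlab L := by
    ext q
    rw [mem_vadd_set_iff_neg_vadd_mem, vadd_eq_add, add_comm]
    exact add_mem_closedSlab_iff (by simp [he])
  have h := fderivWithin_comp_add_right (𝕜 := ℝ) (f := u) (s := closedSlab L) (x := p) e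
  rw [hS] at h
  rw [← h]
  exact fderivWithin_congr hu (hu p hp)

lemma PeriodicYZ.fderivWithin {V : Type*} [NormedAddCommGroup V] [NormedSpace ℝ V] {u : E3 → V}
    (hu : PeriodicYZ L P₁ P₂ u) :
    PeriodicYZ L P₁ P₂ (fderivWithin ℝ u (closedSlab L)) := fun _ hp =>
  ⟨fderivWithin_closedSlab_invariant (by simp [pt]) (fun q hq => (hu q hq).1) hp,
    fderivWithin_closedSlab_invariant (by simp [pt]) (fun q hq => (hu q hq).2) hp⟩

lemma PeriodicYZ.pd {u : E3 → ℝ} (hu : PeriodicYZ L P₁ P₂ u) (j : Fin 3) :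
    PeriodicYZ L P₁ P₂ (pd L j u) :=
  hu.fderivWithin.map fun T => T (coordVec j)

/-- Folding an integral over a set that consists of `Q` and its translate by `-e`. -/
lemma integral_fold {B Q : Set E3} {e : E3} (he : e 0 = 0) (hQ : MeasurableSet Q)
    (hQs : Q ⊆ slab L) (hdisj : Disjoint Q ((fun p => p + e) ⁻¹' Q))
    (hB : B =ᵐ[volume] (Q ∪ (fun p => p + e) ⁻¹' Q : Set E3)) {α K : E3 → ℝ} {c : ℝ}
    (hK : AEInvariant L e K) (hKi : IntegrableOn K B) (hαi : IntegrableOn (fun p => α p * K p) B)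
    (hc : ∀ p ∈ Q, α p + α (p - e) = c) :
    ∫ p in B, α p * K p = c * ∫ p in Q, K p := by
  have hmp : MeasurePreserving (fun p : E3 => p + e) volume volume :=
    measurePreserving_add_right volume e
  have hemb : MeasurableEmbedding (fun p : E3 => p + e) :=
    (Homeomorph.addRight e).measurableEmbedding
  have hQ' : MeasurableSet ((fun p : E3 => p + e) ⁻¹' Q) := hmp.measurable hQ
  have hsub : (fun p : E3 => p + e) ⁻¹' Q ⊆ slab L := fun p hp => (add_mem_slab_iff he).1 (hQs hp)
  have hi := (integrableOn_congr_set_ae hB).1 hαi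
  have hKi' := (integrableOn_congr_set_ae hB).1 hKi
  rw [setIntegral_congr_set hB, setIntegral_union hdisj hQ' (hi.mono_set subset_union_left)
    (hi.mono_set subset_union_right)]
  have heq : (fun p => α p * K p) =ᵐ[volume.restrict ((fun p : E3 => p + e) ⁻¹' Q)]
      fun p => (fun q => α (q - e) * K q) (p + e) := by
    have hKae := ae_restrict_of_ae_restrict_of_subset hsub hK
    filter_upwards [hKae] with p hp
    simp [hp]
  have hshift : ∫ p in (fun p : E3 => p + e) ⁻¹' Q, α p * K p = ∫ q in Q, α (q - e) * K q := by
    rw [integral_congr_ae heq]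
    exact hmp.setIntegral_preimage_emb hemb (fun q => α (q - e) * K q) Q
  have hint : IntegrableOn (fun q => α (q - e) * K q) Q := by
    rw [← hmp.integrableOn_comp_preimage hemb]
    exact ((hi.mono_set subset_union_right).congr heq)
  rw [hshift, ← integral_add (hi.mono_set subset_union_left) hint, ← integral_const_mul]
  refine setIntegral_congr_fun hQ fun p hp => ?_
  rw [← add_mul, hc p hp]

lemma measurableSet_cell (L P₁ P₂ : ℝ) : MeasurableSet (cell L P₁ P₂) := by
  have h (i : Fin 3) : Continuous fun p : E3 => p i := by fun_prop
  exact ((isOpen_Ioo.preimage (h 0)).inter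
    ((isOpen_Ioo.preimage (h 1)).inter (isOpen_Ioo.preimage (h 2)))).measurableSet

lemma cell_subset_box (hP₁ : 0 < P₁) (hP₂ : 0 < P₂) : cell L P₁ P₂ ⊆ box L P₁ P₂ :=
  fun _ hp => ⟨hp.1, ⟨by linarith [hp.2.1.1], hp.2.1.2⟩, ⟨by linarith [hp.2.2.1], hp.2.2.2⟩⟩

/-- Folding the box `(0, L) × (-P₁, P₁) × (-P₂, P₂)` onto the periodicity cell. -/
lemma integral_box_fold (hP₁ : 0 < P₁) (hP₂ : 0 < P₂) {α β : ℝ → ℝ} {a b : ℝ}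
    (hα : Continuous α) (hβ : Continuous β)
    (ha : ∀ t ∈ Ioo 0 P₁, α t + α (t - P₁) = a) (hb : ∀ t ∈ Ioo 0 P₂, β t + β (t - P₂) = b)
    {K : E3 → ℝ} (hK : AEPeriodicYZ L P₁ P₂ K) (hKi : IntegrableOn K (box L P₁ P₂)) :
    ∫ p in box L P₁ P₂, α (p 1) * β (p 2) * K p = a * b * ∫ p in cell L P₁ P₂, K p := by
  set M : Set E3 := {p | p 0 ∈ Ioo 0 L ∧ p 1 ∈ Ioo 0 P₁ ∧ p 2 ∈ Ioo (-P₂) P₂} with hM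
  have hcont (i : Fin 3) : Continuous fun p : E3 => p i := by fun_prop
  have hMm : MeasurableSet M := ((isOpen_Ioo.preimage (hcont 0)).inter
    ((isOpen_Ioo.preimage (hcont 1)).inter (isOpen_Ioo.preimage (hcont 2)))).measurableSet
  have hMbox : M ⊆ box L P₁ P₂ := fun p hp => ⟨hp.1, ⟨by linarith [hp.2.1.1], hp.2.1.2⟩, hp.2.2⟩
  have hmul {κ : E3 → ℝ} (hκ : Continuous κ) {T : E3 → ℝ} (hT : IntegrableOn T (box L P₁ P₂)) :
      IntegrableOn (fun p => κ p * T p) (box L P₁ P₂) := by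
    obtain ⟨C, hC⟩ := exists_bound_box (L := L) P₁ P₂ hκ.continuousOn
    refine Integrable.bdd_mul (c := C) hT hκ.aestronglyMeasurable ?_
    exact (ae_restrict_mem (isOpen_box L P₁ P₂).measurableSet).mono hC
  have hβ' : Continuous fun p : E3 => β (p 2) := hβ.comp (hcont 2)
  have hα' : Continuous fun p : E3 => α (p 1) := hα.comp (hcont 1)
  have h1 : ∫ p in box L P₁ P₂, α (p 1) * (β (p 2) * K p) = a * ∫ p in M, β (p 2) * K p := by
    refine integral_fold (L := L) (e := pt 0 P₁ 0) (by simp [pt]) hMm (fun p hp => hp.1) ?_ ?_ ?_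
      (hmul hβ' hKi) (hmul hα' (hmul hβ' hKi)) ?_
    · rw [Set.disjoint_left]
      rintro p hp hq
      have := hq.2.1.2
      have := hp.2.1.1
      simp [pt] at *
      linarith
    · rw [ae_eq_set]
      constructor
      · refine measure_mono_null ?_ (volume_hyperplane 1 0)
        rintro p ⟨hp, hq⟩
        by_contra h0
        apply hq
        rcases lt_or_gt_of_ne h0 with h | h
        · right
          have := hp.2.1.1
          refine ⟨by simpa [pt] using hp.1, ?_, by simpa [pt] using hp.2.2⟩
          constructor <;> simp [pt] <;> linarith
        · left
          exact ⟨hp.1, ⟨h, hp.2.1.2⟩, hp.2.2⟩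
      · rw [sdiff_eq_empty.2, measure_empty]
        rintro p (hp | hp)
        · exact hMbox hp
        · obtain ⟨h0, h1, h2⟩ := hp
          simp [pt] at h0 h1 h2
          refine ⟨h0, ⟨?_, ?_⟩, h2⟩ <;> linarith
    · filter_upwards [hK] with p hp
      rw [hp.1]
      simp [pt]
    · intro p hp
      simpa [pt] using ha (p 1) hp.2.1
  have h2 : ∫ p in M, β (p 2) * K p = b * ∫ p in cell L P₁ P₂, K p := by
    refine integral_fold (L := L) (e := pt 0 0 P₂) (by simp [pt]) (measurableSet_cell L P₁ P₂)
      (fun p hp => hp.1) ?_ ?_ hK.snd (hKi.mono_set hMbox) ((hmul hβ' hKi).mono_set hMbox) ?_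
    · rw [Set.disjoint_left]
      rintro p hp hq
      have := hq.2.2.2
      have := hp.2.2.1
      simp [pt] at *
      linarith
    · rw [ae_eq_set]
      constructor
      · refine measure_mono_null ?_ (volume_hyperplane 2 0)
        rintro p ⟨hp, hq⟩
        by_contra h0
        apply hq
        rcases lt_or_gt_of_ne h0 with h | h
        · right
          have := hp.2.2.1
          refine ⟨by simpa [pt] using hp.1, by simpa [pt] using hp.2.1, ?_⟩
          constructor <;> simp [pt] <;> linarith
        · left
          exact ⟨hp.1, hp.2.1, ⟨h, hp.2.2.2⟩⟩
      · rw [sdiff_eq_empty.2, measure_empty]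
        rintro p (hp | hp)
        · exact ⟨hp.1, hp.2.1, ⟨by linarith [hp.2.2.1], hp.2.2.2⟩⟩
        · obtain ⟨h0, h1, h2⟩ := hp
          simp [pt] at h0 h1 h2
          refine ⟨h0, h1, ⟨?_, ?_⟩⟩ <;> linarith
    · intro p hp
      simpa [pt] using hb (p 2) hp.2.2
  simp only [mul_assoc] at h1 ⊢
  rw [h1, h2]

/-- A smooth function supported in `[-P, P]` whose `P`-translates sum to one. -/
noncomputable def periodicCutoff (P t : ℝ) : ℝ :=
  Real.smoothTransition (t / P + 1) - Real.smoothTransition (t / P)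

lemma contDiff_periodicCutoff (P : ℝ) : ContDiff ℝ ∞ (periodicCutoff P) := by
  unfold periodicCutoff
  have h : ContDiff ℝ ∞ Real.smoothTransition := Real.smoothTransition.contDiff
  exact (h.comp (by fun_prop)).sub (h.comp (by fun_prop))

lemma periodicCutoff_eq_zero {P t : ℝ} (hP : 0 < P) (ht : P ≤ |t|) : periodicCutoff P t = 0 := by
  unfold periodicCutoff
  rcases le_abs.1 ht with h | h
  · have : 1 ≤ t / P := by rwa [le_div_iff₀ hP, one_mul]
    rw [Real.smoothTransition.one_of_one_le this,
      Real.smoothTransition.one_of_one_le (by linarith), sub_self]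
  · have : t / P ≤ -1 := by rw [div_le_iff₀ hP]; linarith
    rw [Real.smoothTransition.zero_of_nonpos (by linarith),
      Real.smoothTransition.zero_of_nonpos (by linarith), sub_self]

lemma periodicCutoff_add {P t : ℝ} (hP : 0 < P) (ht : t ∈ Ioo 0 P) :
    periodicCutoff P t + periodicCutoff P (t - P) = 1 := by
  unfold periodicCutoff
  have h0 : 0 < t / P := div_pos ht.1 hP
  have h1 : t / P < 1 := (div_lt_one hP).2 ht.2
  have h2 : (t - P) / P = t / P - 1 := by field_simp
  rw [h2, Real.smoothTransition.one_of_one_le (by linarith : 1 ≤ t / P + 1),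
    Real.smoothTransition.zero_of_nonpos (by linarith : t / P - 1 ≤ 0)]
  ring_nf

lemma deriv_periodicCutoff_add {P t : ℝ} (hP : 0 < P) (ht : t ∈ Ioo 0 P) :
    deriv (periodicCutoff P) t + deriv (periodicCutoff P) (t - P) = 0 := by
  have hd : Differentiable ℝ (periodicCutoff P) :=
    (contDiff_periodicCutoff P).differentiable (by simp)
  have h : (fun s => periodicCutoff P s + periodicCutoff P (s - P)) =ᶠ[𝓝 t] fun _ => 1 := by
    filter_upwards [isOpen_Ioo.mem_nhds ht] with s hs using periodicCutoff_add hP hs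
  have h' := h.deriv_eq
  have hd' : DifferentiableAt ℝ (fun s => periodicCutoff P (s - P)) t :=
    (hd _).comp t (by fun_prop)
  rw [deriv_fun_add (hd _) hd', deriv_const, deriv_comp_sub_const] at h'
  exact h'

/-- The cutoff function on `E3` whose periodic translates sum to one. -/
noncomputable def cellCutoff (P₁ P₂ : ℝ) (p : E3) : ℝ :=
  periodicCutoff P₁ (p 1) * periodicCutoff P₂ (p 2)

lemma contDiff_cellCutoff (P₁ P₂ : ℝ) : ContDiff ℝ ∞ (cellCutoff P₁ P₂) := by
  unfold cellCutoff
  exact ((contDiff_periodicCutoff P₁).comp (by fun_prop)).mul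
    ((contDiff_periodicCutoff P₂).comp (by fun_prop))

lemma lateralVanish_cellCutoff (hP₁ : 0 < P₁) (hP₂ : 0 < P₂) :
    LateralVanish L P₁ P₂ (cellCutoff P₁ P₂) := by
  rintro p - (h | h)
  · simp [cellCutoff, periodicCutoff_eq_zero hP₁ h]
  · simp [cellCutoff, periodicCutoff_eq_zero hP₂ h]

lemma hasFDerivAt_coord_comp {ψ : ℝ → ℝ} (hψ : ContDiff ℝ ∞ ψ) (i : Fin 3) (p : E3) :
    HasFDerivAt (fun q : E3 => ψ (q i)) (deriv ψ (p i) • (EuclideanSpace.proj i : E3 →L[ℝ] ℝ)) p :=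
  ((hψ.differentiable (by simp)) (p i)).hasDerivAt.comp_hasFDerivAt p
    (EuclideanSpace.proj i : E3 →L[ℝ] ℝ).hasFDerivAt

lemma pd_cellCutoff (hL : 0 < L) {p : E3} (hp : p ∈ closedSlab L) (j : Fin 3) :
    pd L j (cellCutoff P₁ P₂) p =
      ![0, deriv (periodicCutoff P₁) (p 1) * periodicCutoff P₂ (p 2),
        periodicCutoff P₁ (p 1) * deriv (periodicCutoff P₂) (p 2)] j := by
  rw [pd_eq_fderiv hL ((contDiff_cellCutoff P₁ P₂).of_le (by simp)) hp]
  have h := (hasFDerivAt_coord_comp (contDiff_periodicCutoff P₁) 1 p).mul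
    (hasFDerivAt_coord_comp (contDiff_periodicCutoff P₂) 2 p)
  have h' : fderiv ℝ (cellCutoff P₁ P₂) p = _ := h.fderiv
  rw [h']
  fin_cases j <;> simp [mul_comm]

lemma integral_cellCutoff_mul (hP₁ : 0 < P₁) (hP₂ : 0 < P₂) {K : E3 → ℝ}
    (hK : AEPeriodicYZ L P₁ P₂ K) (hKi : IntegrableOn K (box L P₁ P₂)) :
    ∫ p in box L P₁ P₂, cellCutoff P₁ P₂ p * K p = ∫ p in cell L P₁ P₂, K p := by
  have := integral_box_fold hP₁ hP₂ (contDiff_periodicCutoff P₁).continuous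
    (contDiff_periodicCutoff P₂).continuous (fun t => periodicCutoff_add hP₁)
    (fun t => periodicCutoff_add hP₂) hK hKi
  simpa [cellCutoff] using this

/-- The derivatives of the cutoff integrate to zero against periodic functions, since the
translates of the cutoff sum to a constant. -/
lemma integral_pd_cellCutoff_mul (hL : 0 < L) (hP₁ : 0 < P₁) (hP₂ : 0 < P₂) {K : E3 → ℝ}
    (hK : AEPeriodicYZ L P₁ P₂ K) (hKi : IntegrableOn K (box L P₁ P₂)) (j : Fin 3) :
    ∫ p in box L P₁ P₂, pd L j (cellCutoff P₁ P₂) p * K p = 0 := by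
  have hcongr : ∫ p in box L P₁ P₂, pd L j (cellCutoff P₁ P₂) p * K p =
      ∫ p in box L P₁ P₂, ![0, deriv (periodicCutoff P₁) (p 1) * periodicCutoff P₂ (p 2),
        periodicCutoff P₁ (p 1) * deriv (periodicCutoff P₂) (p 2)] j * K p := by
    refine setIntegral_congr_fun (isOpen_box L P₁ P₂).measurableSet fun p hp => ?_
    simp only
    rw [pd_cellCutoff hL (slab_subset_closedSlab L (box_subset_slab L P₁ P₂ hp))]
  rw [hcongr]
  have hc (P : ℝ) : Continuous (periodicCutoff P) := (contDiff_periodicCutoff P).continuous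
  have hd (P : ℝ) : Continuous (deriv (periodicCutoff P)) :=
    (contDiff_periodicCutoff P).continuous_deriv (by simp)
  fin_cases j
  · simp
  · have := integral_box_fold hP₁ hP₂ (hd P₁) (hc P₂) (fun t => deriv_periodicCutoff_add hP₁)
      (fun t => periodicCutoff_add hP₂) hK hKi
    simpa using this
  · have := integral_box_fold hP₁ hP₂ (hc P₁) (hd P₂) (fun t => periodicCutoff_add hP₁)
      (fun t => deriv_periodicCutoff_add hP₂) hK hKi
    simpa using this

end

section

/-! ### Integral identities for periodic variations -/

variable {L P₁ P₂ : ℝ} {F G : E3 → ℝ} {DF DG : E3 → E3}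

lemma exists_box_of_compact {K : Set E3} (hK : IsCompact K) (hKs : K ⊆ slab L) :
    ∃ R, 0 < R ∧ K ⊆ box L R R := by
  obtain ⟨R, hR⟩ := hK.isBounded.subset_ball (0 : E3)
  refine ⟨max R 1, by positivity, fun p hp => ⟨hKs hp, ?_⟩⟩
  have hn : ‖p‖ < max R 1 := lt_of_lt_of_le (by simpa using hR hp) (le_max_left _ _)
  have h (i : Fin 3) : p i ∈ Ioo (-max R 1) (max R 1) :=
    abs_lt.1 (lt_of_le_of_lt (PiLp.norm_apply_le p i) hn)
  exact ⟨h 1, h 2⟩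

/-- The weak formulation of the gradient, against test functions of the open slab. -/
lemma AdmissibleVariation.integral_test (hL : 0 < L) (hF : AdmissibleVariation L P₁ P₂ F DF)
    {φ : E3 → ℝ} (hφ : ContDiff ℝ ∞ φ) (hc : HasCompactSupport φ) (hs : tsupport φ ⊆ slab L)
    (j : Fin 3) :
    Integrable (fun p => φ p * DF p j) ∧ Integrable (fun p => fderiv ℝ φ p (coordVec j) * F p) ∧
    (∫ p, fderiv ℝ φ p (coordVec j) * F p) + ∫ p, φ p * DF p j = 0 := by
  obtain ⟨R, hR, hbox⟩ := exists_box_of_compact hc hs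
  have h0 : ∀ p ∉ box L R R, φ p = 0 := fun p hp =>
    image_eq_zero_of_notMem_tsupport fun h => hp (hbox h)
  have h1 : ∀ p ∉ box L R R, fderiv ℝ φ p (coordVec j) = 0 := fun p hp => by
    have : fderiv ℝ φ p = 0 := image_eq_zero_of_notMem_tsupport fun h =>
      hp (hbox (tsupport_fderiv_subset ℝ h))
    simp [this]
  have hφ1 : ContDiff ℝ 1 φ := hφ.of_le (by simp)
  have key := hF.integral_mul_pd (R₁ := R) (R₂ := R) hL hR hR hφ1.contDiffOn (by
    intro p _ h
    refine h0 p fun hp => ?_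
    rcases h with h | h
    · exact absurd (abs_lt.2 hp.2.1) (not_lt.2 h)
    · exact absurd (abs_lt.2 hp.2.2) (not_lt.2 h)) j
  have hcongr : ∫ p in box L R R, pd L j φ p * F p =
      ∫ p in box L R R, fderiv ℝ φ p (coordVec j) * F p :=
    setIntegral_congr_fun (isOpen_box L R R).measurableSet fun p hp => by
      simp only [pd_eq_fderiv_of_mem_slab (box_subset_slab L R R hp)]
  rw [hcongr, setIntegral_eq_integral_of_forall_compl_eq_zero (fun p hp => by simp [h1 p hp]),
    setIntegral_eq_integral_of_forall_compl_eq_zero (fun p hp => by simp [h0 p hp])] at key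
  refine ⟨?_, ?_, key⟩
  · rw [← integrableOn_iff_integrable_of_support_subset (s := box L R R)]
    · exact integrable_mul_of_L2 (memLp_of_continuousOn hφ.continuous.continuousOn)
        (hF.memLp_grad_box R R j)
    · intro p hp
      by_contra h
      exact hp (by simp [h0 p h])
  · rw [← integrableOn_iff_integrable_of_support_subset (s := box L R R)]
    · exact integrable_mul_of_L2
        (memLp_of_continuousOn (contDiff_fderiv_coord hφ).continuous.continuousOn)
        (hF.memLp_box R R)
    · intro p hp
      by_contra h
      exact hp (by simp [h1 p h])

/-- Translation invariance passes from a variation to its weak gradient. -/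
lemma AdmissibleVariation.invariant_grad (hL : 0 < L) (hF : AdmissibleVariation L P₁ P₂ F DF)
    {e : E3} (he : e 0 = 0) (hinv : AEInvariant L e F) (j : Fin 3) :
    AEInvariant L e fun p => DF p j := by
  have hmp : MeasurePreserving (fun p : E3 => p + e) volume volume :=
    measurePreserving_add_right volume e
  have hemb : MeasurableEmbedding (fun p : E3 => p + e) :=
    (Homeomorph.addRight e).measurableEmbedding
  have hloc : LocallyIntegrableOn (fun p => DF (p + e) j - DF p j) (slab L) := by
    intro x hx
    obtain ⟨R, hR, hx⟩ := exists_box_of_compact (K := {x}) isCompact_singleton (by simpa using hx)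
    refine ⟨box L R R, mem_nhdsWithin_of_mem_nhds ((isOpen_box L R R).mem_nhds (hx rfl)), ?_⟩
    have hint (r : ℝ) : IntegrableOn (fun p => DF p j) (box L r r) := by
      have := isFiniteMeasure_box L r r
      exact (hF.memLp_grad_box r r j).integrable (by norm_num)
    refine Integrable.sub ?_ (hint R)
    obtain ⟨r, hr⟩ : ∃ r, R + |e 1| ≤ r ∧ R + |e 2| ≤ r :=
      ⟨max (R + |e 1|) (R + |e 2|), le_max_left _ _, le_max_right _ _⟩
    have h2 := (hmp.integrableOn_comp_preimage hemb (s := box L r r)).2 (hint r)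
    refine IntegrableOn.mono_set h2 ?_
    intro p hp
    obtain ⟨h0, h1, h2⟩ := hp
    have a1 := abs_le.1 (le_refl |e 1|)
    have a2 := abs_le.1 (le_refl |e 2|)
    refine ⟨by simpa [he] using h0, ⟨?_, ?_⟩, ⟨?_, ?_⟩⟩ <;> simp <;>
      linarith [h1.1, h1.2, h2.1, h2.2]
  have hz := (isOpen_slab L).ae_eq_zero_of_integral_contDiff_smul_eq_zero hloc ?_
  · rw [AEInvariant, ae_restrict_iff' (isOpen_slab L).measurableSet]
    filter_upwards [hz] with p hp hps
    exact sub_eq_zero.1 (hp hps)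
  intro φ hφ hc hs
  obtain ⟨i1, i2, hid⟩ := hF.integral_test hL hφ hc hs j
  -- Testing with `φ` and with its translate gives the same value of `∫ ∂ⱼφ F`.
  set φe : E3 → ℝ := fun p => φ (p + -e) with hφe
  have hφe1 : ContDiff ℝ ∞ φe := hφ.comp (by fun_prop)
  have hce : HasCompactSupport φe := hc.comp_homeomorph (Homeomorph.addRight (-e))
  have hse : tsupport φe ⊆ slab L := by
    intro p hp
    have : p + -e ∈ tsupport φ :=
      tsupport_comp_subset_preimage φ (f := fun p : E3 => p + -e) (by fun_prop) hp
    exact (add_mem_slab_iff (by simp [he])).1 (hs this)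
  obtain ⟨i3, i4, hide⟩ := hF.integral_test hL hφe1 hce hse j
  have s1 : ∫ p, φe p * DF p j = ∫ p, φ p * DF (p + e) j := by
    rw [← integral_add_right_eq_self (μ := volume) (fun p => φe p * DF p j) e]
    simp [hφe]
  have s2 : ∫ p, fderiv ℝ φe p (coordVec j) * F p = ∫ p, fderiv ℝ φ p (coordVec j) * F p := by
    rw [← integral_add_right_eq_self (μ := volume) (fun p => fderiv ℝ φe p (coordVec j) * F p) e]
    refine integral_congr_ae ?_
    have hinv' : ∀ᵐ p : E3, p ∈ slab L → F (p + e) = F p :=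
      (ae_restrict_iff' (isOpen_slab L).measurableSet).1 hinv
    filter_upwards [hinv'] with p hp
    have hd : fderiv ℝ φe (p + e) = fderiv ℝ φ p := by
      rw [hφe, fderiv_comp_add_right]
      simp
    rw [hd]
    by_cases hps : p ∈ slab L
    · rw [hp hps]
    · have : fderiv ℝ φ p = 0 := image_eq_zero_of_notMem_tsupport fun h =>
        hps (hs (tsupport_fderiv_subset ℝ h))
      simp [this]
  have i5 : Integrable (fun p => φ p * DF (p + e) j) := by
    have := i3.comp_add_right e
    simpa [hφe] using this
  have : ∫ p, φ p • (DF (p + e) j - DF p j) = 0 := by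
    simp only [smul_eq_mul, mul_sub]
    rw [integral_sub i5 i1, ← s1]
    rw [s2] at hide
    linarith
  exact this

lemma AdmissibleVariation.periodic_grad (hL : 0 < L) (hF : AdmissibleVariation L P₁ P₂ F DF)
    (j : Fin 3) : AEPeriodicYZ L P₁ P₂ fun p => DF p j := by
  filter_upwards [hF.invariant_grad hL (by simp [pt]) hF.periodic.fst j,
    hF.invariant_grad hL (by simp [pt]) hF.periodic.snd j] with p h1 h2 using ⟨h1, h2⟩

lemma integral_box_cutoff (hL : 0 < L) (hP₁ : 0 < P₁) (hP₂ : 0 < P₂) {ξ A B : E3 → ℝ}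
    (hξ : ContinuousOn ξ (closedSlab L)) (hξp : PeriodicYZ L P₁ P₂ ξ)
    (hA : MemLp A 2 (volume.restrict (box L P₁ P₂))) (hAp : AEPeriodicYZ L P₁ P₂ A)
    (hB : MemLp B 2 (volume.restrict (box L P₁ P₂))) (hBp : AEPeriodicYZ L P₁ P₂ B) :
    ((∫ p in box L P₁ P₂, cellCutoff P₁ P₂ p * ξ p * A p * B p) =
      ∫ p in cell L P₁ P₂, ξ p * A p * B p) ∧
    ∀ j, ∫ p in box L P₁ P₂, pd L j (cellCutoff P₁ P₂) p * ξ p * A p * B p = 0 := by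
  have hp : AEPeriodicYZ L P₁ P₂ fun p => ξ p * A p * B p :=
    (hξp.ae.map₂ (· * ·) hAp).map₂ (· * ·) hBp
  have hi : IntegrableOn (fun p => ξ p * A p * B p) (box L P₁ P₂) :=
    integrable_mul_of_L2 (memLp_mul_of_continuousOn hξ hA) hB
  constructor
  · rw [← integral_cellCutoff_mul hP₁ hP₂ hp hi]
    simp only [mul_assoc]
  · intro j
    rw [← integral_pd_cellCutoff_mul hL hP₁ hP₂ hp hi j]
    simp only [mul_assoc]

lemma integral_box_pd_cutoff (hL : 0 < L) (hP₁ : 0 < P₁) (hP₂ : 0 < P₂) {ξ A B : E3 → ℝ}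
    (hξ : ContDiffOn ℝ 1 ξ (closedSlab L)) (hξp : PeriodicYZ L P₁ P₂ ξ)
    (hA : MemLp A 2 (volume.restrict (box L P₁ P₂))) (hAp : AEPeriodicYZ L P₁ P₂ A)
    (hB : MemLp B 2 (volume.restrict (box L P₁ P₂))) (hBp : AEPeriodicYZ L P₁ P₂ B) (j : Fin 3) :
    ∫ p in box L P₁ P₂, pd L j (fun q => cellCutoff P₁ P₂ q * ξ q) p * A p * B p =
      ∫ p in cell L P₁ P₂, pd L j ξ p * A p * B p := by
  have hχ : ContDiffOn ℝ 1 (cellCutoff P₁ P₂) (closedSlab L) :=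
    ((contDiff_cellCutoff P₁ P₂).of_le (by simp)).contDiffOn
  have h1 := (integral_box_cutoff hL hP₁ hP₂ (continuousOn_pd (j := j) hL hξ) (hξp.pd j)
    hA hAp hB hBp).1
  have h2 := (integral_box_cutoff hL hP₁ hP₂ hξ.continuousOn hξp hA hAp hB hBp).2 j
  have i1 := integrable_mul_of_L2 (memLp_mul_of_continuousOn
    (hχ.continuousOn.mul (continuousOn_pd (j := j) hL hξ)) hA) hB
  have i2 := integrable_mul_of_L2 (memLp_mul_of_continuousOn
    ((continuousOn_pd (j := j) hL hχ).mul hξ.continuousOn) hA) hB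
  have h12 := integral_add i1 i2
  simp only [Pi.mul_apply] at h12
  rw [h1, h2, add_zero] at h12
  rw [← h12]
  refine setIntegral_congr_fun (isOpen_box L P₁ P₂).measurableSet fun p hp => ?_
  rw [pd_mul hL hχ hξ (slab_subset_closedSlab L (box_subset_slab L P₁ P₂ hp))]
  ring

lemma integrable_cell (hP₁ : 0 < P₁) (hP₂ : 0 < P₂) {ξ A B : E3 → ℝ}
    (hξ : ContinuousOn ξ (closedSlab L))
    (hA : MemLp A 2 (volume.restrict (box L P₁ P₂)))
    (hB : MemLp B 2 (volume.restrict (box L P₁ P₂))) :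
    IntegrableOn (fun p => ξ p * A p * B p) (cell L P₁ P₂) :=
  IntegrableOn.mono_set (integrable_mul_of_L2 (memLp_mul_of_continuousOn hξ hA) hB)
    (cell_subset_box hP₁ hP₂)

/-- Integrating a total derivative over the periodicity cell gives zero. -/
lemma AdmissibleVariation.integral_cell_product_rule (hL : 0 < L) (hP₁ : 0 < P₁) (hP₂ : 0 < P₂)
    (hF : AdmissibleVariation L P₁ P₂ F DF) (hG : AdmissibleVariation L P₁ P₂ G DG) {ξ : E3 → ℝ}
    (hξ : ContDiffOn ℝ 1 ξ (closedSlab L)) (hξp : PeriodicYZ L P₁ P₂ ξ) (j : Fin 3) :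
    IntegrableOn (fun p => pd L j ξ p * F p * G p + (ξ p * F p * DG p j + ξ p * DF p j * G p))
      (cell L P₁ P₂) ∧
    ∫ p in cell L P₁ P₂, (pd L j ξ p * F p * G p + (ξ p * F p * DG p j + ξ p * DF p j * G p))
      = 0 := by
  have mF := hF.memLp_box P₁ P₂
  have mG := hG.memLp_box P₁ P₂
  have mDF := hF.memLp_grad_box P₁ P₂ j
  have mDG := hG.memLp_grad_box P₁ P₂ j
  have pF := hF.periodic
  have pG := hG.periodic
  have pDF := hF.periodic_grad hL j
  have pDG := hG.periodic_grad hL j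
  have hχ : ContDiffOn ℝ 1 (cellCutoff P₁ P₂) (closedSlab L) :=
    ((contDiff_cellCutoff P₁ P₂).of_le (by simp)).contDiffOn
  have key := hF.integral_product_rule hL hP₁ hP₂ hG (hχ.mul hξ)
    (fun p hp h => by simp [lateralVanish_cellCutoff hP₁ hP₂ p hp h]) j
  rw [integral_box_pd_cutoff hL hP₁ hP₂ hξ hξp mF pF mG pG,
    (integral_box_cutoff hL hP₁ hP₂ hξ.continuousOn hξp mF pF mDG pDG).1,
    (integral_box_cutoff hL hP₁ hP₂ hξ.continuousOn hξp mDF pDF mG pG).1] at key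
  have i1 := integrable_cell hP₁ hP₂ (continuousOn_pd (j := j) hL hξ) mF mG
  have i2 := integrable_cell hP₁ hP₂ hξ.continuousOn mF mDG
  have i3 := integrable_cell hP₁ hP₂ hξ.continuousOn mDF mG
  refine ⟨i1.add (i2.add i3), ?_⟩
  have := integral_add i1 (i2.add i3)
  have h' := integral_add i2 i3
  simp only [Pi.add_apply] at this
  rw [this, h', key]

/-- The null Lagrangian identity for the minors of the gradients, over the periodicity cell. -/
lemma AdmissibleVariation.integral_cell_minor (hL : 0 < L) (hP₁ : 0 < P₁) (hP₂ : 0 < P₂)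
    (hF : AdmissibleVariation L P₁ P₂ F DF) (hG : AdmissibleVariation L P₁ P₂ G DG) {ξ : E3 → ℝ}
    (hξ : ContDiffOn ℝ 1 ξ (closedSlab L)) (hξp : PeriodicYZ L P₁ P₂ ξ) (j k : Fin 3) :
    IntegrableOn (fun p => (ξ p * DF p j * DG p k + pd L j ξ p * F p * DG p k) -
      (ξ p * DF p k * DG p j + pd L k ξ p * F p * DG p j)) (cell L P₁ P₂) ∧
    ∫ p in cell L P₁ P₂, ((ξ p * DF p j * DG p k + pd L j ξ p * F p * DG p k) -
      (ξ p * DF p k * DG p j + pd L k ξ p * F p * DG p j)) = 0 := by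
  have mF := hF.memLp_box P₁ P₂
  have mDF (i : Fin 3) := hF.memLp_grad_box P₁ P₂ i
  have mDG (i : Fin 3) := hG.memLp_grad_box P₁ P₂ i
  have pF := hF.periodic
  have pDF (i : Fin 3) := hF.periodic_grad hL i
  have pDG (i : Fin 3) := hG.periodic_grad hL i
  have hχ : ContDiffOn ℝ 1 (cellCutoff P₁ P₂) (closedSlab L) :=
    ((contDiff_cellCutoff P₁ P₂).of_le (by simp)).contDiffOn
  have key := hF.integral_minor hL hP₁ hP₂ hG (hχ.mul hξ)
    (fun p hp h => by simp [lateralVanish_cellCutoff hP₁ hP₂ p hp h]) j k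
  rw [integral_box_pd_cutoff hL hP₁ hP₂ hξ hξp mF pF (mDG k) (pDG k),
    integral_box_pd_cutoff hL hP₁ hP₂ hξ hξp mF pF (mDG j) (pDG j),
    (integral_box_cutoff hL hP₁ hP₂ hξ.continuousOn hξp (mDF j) (pDF j) (mDG k) (pDG k)).1,
    (integral_box_cutoff hL hP₁ hP₂ hξ.continuousOn hξp (mDF k) (pDF k) (mDG j) (pDG j)).1] at key
  have i1 (i l : Fin 3) := integrable_cell hP₁ hP₂ hξ.continuousOn (mDF i) (mDG l)
  have i2 (i l : Fin 3) := integrable_cell hP₁ hP₂ (continuousOn_pd (j := i) hL hξ) mF (mDG l)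
  refine ⟨((i1 j k).add (i2 j k)).sub ((i1 k j).add (i2 k j)), ?_⟩
  have h := integral_sub ((i1 j k).add (i2 j k)) ((i1 k j).add (i2 k j))
  simp only [Pi.add_apply] at h
  rw [h, integral_add (i1 j k) (i2 j k), integral_add (i1 k j) (i2 k j), key]

end

section

/-! ### Functions that are `C¹`-close to constants -/

variable {L P₁ P₂ : ℝ}

/-- A periodic function of class `C¹` on the closed slab whose values are within `ε` of the constant
`c` and whose partial derivatives are at most `ε`. -/
structure NearConst (L P₁ P₂ c ε : ℝ) (u : E3 → ℝ) : Prop where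
  contDiff : ContDiffOn ℝ 1 u (closedSlab L)
  periodic : PeriodicYZ L P₁ P₂ u
  value : ∀ p ∈ closedSlab L, |u p - c| ≤ ε
  deriv : ∀ p ∈ closedSlab L, ∀ j, |pd L j u p| ≤ ε

/-- A family of periodic functions that tends to the constant `c` in `C¹`, uniformly on the closed
slab, along the filter `l`. -/
def TendsC1 {ι : Type*} (l : Filter ι) (L P₁ P₂ c : ℝ) (U : ι → E3 → ℝ) : Prop :=
  ∀ ε > 0, ∀ᶠ i in l, NearConst L P₁ P₂ c ε (U i)

lemma NearConst.congr {c ε : ℝ} {u w : E3 → ℝ} (hu : NearConst L P₁ P₂ c ε u)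
    (h : ∀ p ∈ closedSlab L, w p = u p) : NearConst L P₁ P₂ c ε w where
  contDiff := hu.contDiff.congr h
  periodic p hp := by
    have h1 : p + pt 0 P₁ 0 ∈ closedSlab L := (add_mem_closedSlab_iff (by simp [pt])).2 hp
    have h2 : p + pt 0 0 P₂ ∈ closedSlab L := (add_mem_closedSlab_iff (by simp [pt])).2 hp
    rw [h p hp, h _ h1, h _ h2]
    exact hu.periodic p hp
  value p hp := by rw [h p hp]; exact hu.value p hp
  deriv p hp j := by
    have : pd L j w p = pd L j u p := by
      rw [pd, pd, fderivWithin_congr h (h p hp)]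
    rw [this]
    exact hu.deriv p hp j

variable {ι : Type*} {l : Filter ι} {c d : ℝ} {U V : ι → E3 → ℝ}

lemma TendsC1.congr (hU : TendsC1 l L P₁ P₂ c U)
    (h : ∀ᶠ i in l, ∀ p ∈ closedSlab L, V i p = U i p) : TendsC1 l L P₁ P₂ c V := by
  intro ε hε
  filter_upwards [hU ε hε, h] with i h1 h2 using h1.congr h2

lemma TendsC1.of_eq (hU : TendsC1 l L P₁ P₂ c U) (h : c = d) : TendsC1 l L P₁ P₂ d U := h ▸ hU

lemma TendsC1.add (hL : 0 < L) (hU : TendsC1 l L P₁ P₂ c U) (hV : TendsC1 l L P₁ P₂ d V) :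
    TendsC1 l L P₁ P₂ (c + d) fun i p => U i p + V i p := by
  intro ε hε
  filter_upwards [hU (ε / 2) (by linarith), hV (ε / 2) (by linarith)] with i hu hv
  refine ⟨hu.contDiff.add hv.contDiff, hu.periodic.map₂ (· + ·) hv.periodic, fun p hp => ?_,
    fun p hp j => ?_⟩
  · have h1 := abs_le.1 (hu.value p hp)
    have h2 := abs_le.1 (hv.value p hp)
    exact abs_le.2 ⟨by linarith, by linarith⟩
  · rw [pd_add hL hu.contDiff hv.contDiff hp]
    have h1 := abs_le.1 (hu.deriv p hp j)
    have h2 := abs_le.1 (hv.deriv p hp j)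
    exact abs_le.2 ⟨by linarith, by linarith⟩

lemma TendsC1.sub (hL : 0 < L) (hU : TendsC1 l L P₁ P₂ c U) (hV : TendsC1 l L P₁ P₂ d V) :
    TendsC1 l L P₁ P₂ (c - d) fun i p => U i p - V i p := by
  intro ε hε
  filter_upwards [hU (ε / 2) (by linarith), hV (ε / 2) (by linarith)] with i hu hv
  refine ⟨hu.contDiff.sub hv.contDiff, hu.periodic.map₂ (· - ·) hv.periodic, fun p hp => ?_,
    fun p hp j => ?_⟩
  · have h1 := abs_le.1 (hu.value p hp)
    have h2 := abs_le.1 (hv.value p hp)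
    exact abs_le.2 ⟨by linarith, by linarith⟩
  · rw [pd_sub hL hu.contDiff hv.contDiff hp]
    have h1 := abs_le.1 (hu.deriv p hp j)
    have h2 := abs_le.1 (hv.deriv p hp j)
    exact abs_le.2 ⟨by linarith, by linarith⟩

lemma abs_mul_add_mul_le {x y z w M N δ : ℝ} (hx : |x| ≤ M) (hy : |y| ≤ δ) (hz : |z| ≤ N)
    (hw : |w| ≤ δ) : |x * y + z * w| ≤ (M + N) * δ := by
  have hM := (abs_nonneg x).trans hx
  have hN := (abs_nonneg z).trans hz
  calc |x * y + z * w| ≤ |x * y| + |z * w| := abs_add_le _ _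
    _ ≤ M * δ + N * δ := by rw [abs_mul, abs_mul]; gcongr
    _ = (M + N) * δ := by ring

lemma TendsC1.mul (hL : 0 < L) (hU : TendsC1 l L P₁ P₂ c U) (hV : TendsC1 l L P₁ P₂ d V) :
    TendsC1 l L P₁ P₂ (c * d) fun i p => U i p * V i p := by
  intro ε hε
  set M := (|c| + 1) + (|d| + 1) with hM
  have hMpos : 0 < M := by positivity
  set δ := min 1 (ε / M) with hδ
  have hδpos : 0 < δ := lt_min one_pos (by positivity)
  have hδ1 : δ ≤ 1 := min_le_left _ _
  have hMδ : M * δ ≤ ε := by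
    calc M * δ ≤ M * (ε / M) := by gcongr; exact min_le_right _ _
      _ = ε := by field_simp
  filter_upwards [hU δ hδpos, hV δ hδpos] with i hu hv
  have bu : ∀ p ∈ closedSlab L, |U i p| ≤ |c| + 1 := fun p hp => by
    have := abs_sub_abs_le_abs_sub (U i p) c
    linarith [hu.value p hp]
  have bv : ∀ p ∈ closedSlab L, |V i p| ≤ |d| + 1 := fun p hp => by
    have := abs_sub_abs_le_abs_sub (V i p) d
    linarith [hv.value p hp]
  refine ⟨hu.contDiff.mul hv.contDiff, hu.periodic.map₂ (· * ·) hv.periodic, fun p hp => ?_,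
    fun p hp j => ?_⟩
  · have h : U i p * V i p - c * d = U i p * (V i p - d) + d * (U i p - c) := by ring
    rw [h]
    exact (abs_mul_add_mul_le (bu p hp) (hv.value p hp) (by linarith : |d| ≤ |d| + 1)
      (hu.value p hp)).trans hMδ
  · rw [pd_mul hL hu.contDiff hv.contDiff hp]
    exact (abs_mul_add_mul_le (bu p hp) (hv.deriv p hp j) (bv p hp) (hu.deriv p hp j)).trans hMδ

lemma pd_inv (hL : 0 < L) {u : E3 → ℝ} (hu : ContDiffOn ℝ 1 u (closedSlab L))
    {p : E3} (hp : p ∈ closedSlab L) (h0 : u p ≠ 0) (j : Fin 3) :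
    pd L j (fun q => (u q)⁻¹) p = -((u p)⁻¹ * (u p)⁻¹) * pd L j u p := by
  have h1 : HasFDerivWithinAt (fun q => (u q)⁻¹)
      (-((u p) ^ 2)⁻¹ • fderivWithin ℝ u (closedSlab L) p) (closedSlab L) p :=
    (hasDerivAt_inv h0).comp_hasFDerivWithinAt p (diffWithin hu hp).hasFDerivWithinAt
  rw [pd, h1.fderivWithin (uniqueDiffOn_closedSlab hL p hp), pd]
  simp
  left
  field_simp

lemma TendsC1.inv (hL : 0 < L) (hc : c ≠ 0) (hU : TendsC1 l L P₁ P₂ c U) :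
    TendsC1 l L P₁ P₂ c⁻¹ fun i p => (U i p)⁻¹ := by
  intro ε hε
  have hc' : 0 < |c| := abs_pos.2 hc
  set δ := min (|c| / 2) (ε * |c| ^ 2 / 4) with hδ
  have hδpos : 0 < δ := lt_min (by positivity) (by positivity)
  filter_upwards [hU δ hδpos] with i hu
  have bl : ∀ p ∈ closedSlab L, |c| / 2 ≤ |U i p| := fun p hp => by
    have h1 := abs_sub_abs_le_abs_sub c (U i p)
    have h2 := hu.value p hp
    rw [abs_sub_comm] at h2
    have h3 : δ ≤ |c| / 2 := min_le_left _ _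
    linarith
  have hδ2 : δ ≤ ε * |c| ^ 2 / 4 := min_le_right _ _
  have hne : ∀ p ∈ closedSlab L, U i p ≠ 0 := fun p hp => by
    have := bl p hp
    exact abs_pos.1 (by linarith)
  refine ⟨hu.contDiff.inv hne, hu.periodic.map (·⁻¹), fun p hp => ?_, fun p hp j => ?_⟩
  · have hU0 := hne p hp
    have hpos : 0 < |U i p| := abs_pos.2 hU0
    have h : (U i p)⁻¹ - c⁻¹ = -(U i p - c) / (U i p * c) := by field_simp; ring
    rw [h, abs_div, abs_neg, abs_mul, div_le_iff₀ (by positivity)]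
    calc |U i p - c| ≤ ε * |c| ^ 2 / 4 := (hu.value p hp).trans hδ2
      _ ≤ ε * (|c| / 2 * |c|) := by nlinarith [mul_pos hε (mul_pos hc' hc')]
      _ ≤ ε * (|U i p| * |c|) := by gcongr; exact bl p hp
  · have hpos : 0 < |U i p| := abs_pos.2 (hne p hp)
    have e1 : pd L j (fun q => (U i q)⁻¹) p = -((U i p)⁻¹ * (U i p)⁻¹) * pd L j (U i) p :=
      pd_inv hL hu.contDiff hp (hne p hp) j
    have e2 : |pd L j (fun q => (U i q)⁻¹) p| = |pd L j (U i) p| / (|U i p| * |U i p|) := by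
      rw [e1, abs_mul, abs_neg, abs_mul, abs_inv]
      field_simp
    rw [e2, div_le_iff₀ (by positivity)]
    calc |pd L j (U i) p| ≤ ε * |c| ^ 2 / 4 := (hu.deriv p hp j).trans hδ2
      _ = ε * (|c| / 2 * (|c| / 2)) := by ring
      _ ≤ ε * (|U i p| * |U i p|) := by gcongr <;> exact bl p hp

/-- Convergence to a constant in `C¹`, together with convergence of the first derivatives to zero
in `C¹`. -/
def TendsC2 {ι : Type*} (l : Filter ι) (L P₁ P₂ c : ℝ) (U : ι → E3 → ℝ) : Prop :=
  TendsC1 l L P₁ P₂ c U ∧ ∀ j, TendsC1 l L P₁ P₂ 0 fun i => pd L j (U i)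

lemma TendsC2.sub (hL : 0 < L) (hU : TendsC2 l L P₁ P₂ c U) (hV : TendsC2 l L P₁ P₂ d V) :
    TendsC2 l L P₁ P₂ (c - d) fun i p => U i p - V i p := by
  refine ⟨hU.1.sub hL hV.1, fun j => ?_⟩
  refine (((hU.2 j).sub hL (hV.2 j)).of_eq (sub_zero 0)).congr ?_
  filter_upwards [hU.1 1 one_pos, hV.1 1 one_pos] with i hu hv p hp
    using pd_sub hL hu.contDiff hv.contDiff hp

lemma TendsC2.mul (hL : 0 < L) (hU : TendsC2 l L P₁ P₂ c U) (hV : TendsC2 l L P₁ P₂ d V) :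
    TendsC2 l L P₁ P₂ (c * d) fun i p => U i p * V i p := by
  refine ⟨hU.1.mul hL hV.1, fun j => ?_⟩
  refine (((hU.1.mul hL (hV.2 j)).add hL (hV.1.mul hL (hU.2 j))).of_eq (by ring)).congr ?_
  filter_upwards [hU.1 1 one_pos, hV.1 1 one_pos] with i hu hv p hp
    using pd_mul hL hu.contDiff hv.contDiff hp

/-! ### Control of the derivatives by the norm over the closed cell -/

lemma PeriodicYZ.exists_closedCell {α : Type*} {u : E3 → α} (hu : PeriodicYZ L P₁ P₂ u)
    (hP₁ : 0 < P₁) (hP₂ : 0 < P₂) {p : E3} (hp : p ∈ closedSlab L) :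
    ∃ q ∈ closedCell L P₁ P₂, u q = u p := by
  have shift1 (n : ℤ) : ∀ q ∈ closedSlab L, u (q + n • pt 0 P₁ 0) = u q := by
    induction n using Int.induction_on with
    | zero => simp
    | succ n ih =>
      intro q hq
      rw [add_smul, one_smul, ← add_assoc]
      rw [(hu _ ((add_mem_closedSlab_iff (by simp [pt])).2 hq)).1, ih q hq]
    | pred n ih =>
      intro q hq
      have hq' : q + (-(n : ℤ) - 1) • pt 0 P₁ 0 ∈ closedSlab L :=
        (add_mem_closedSlab_iff (by simp [pt])).2 hq
      rw [← (hu _ hq').1, ← ih q hq, sub_smul, one_smul]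
      congr 1
      abel
  have shift2 (n : ℤ) : ∀ q ∈ closedSlab L, u (q + n • pt 0 0 P₂) = u q := by
    induction n using Int.induction_on with
    | zero => simp
    | succ n ih =>
      intro q hq
      rw [add_smul, one_smul, ← add_assoc]
      rw [(hu _ ((add_mem_closedSlab_iff (by simp [pt])).2 hq)).2, ih q hq]
    | pred n ih =>
      intro q hq
      have hq' : q + (-(n : ℤ) - 1) • pt 0 0 P₂ ∈ closedSlab L :=
        (add_mem_closedSlab_iff (by simp [pt])).2 hq
      rw [← (hu _ hq').2, ← ih q hq, sub_smul, one_smul]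
      congr 1
      abel
  have hfl {P t : ℝ} (hP : 0 < P) : t + (-⌊t / P⌋ : ℤ) * P ∈ Icc 0 P := by
    have h1 := Int.floor_le (t / P)
    have h2 := (Int.lt_floor_add_one (t / P)).le
    rw [le_div_iff₀ hP] at h1
    rw [div_le_iff₀ hP] at h2
    push_cast
    constructor <;> nlinarith
  set n₁ : ℤ := -⌊p 1 / P₁⌋
  set n₂ : ℤ := -⌊p 2 / P₂⌋
  have hp1 : p + n₁ • pt 0 P₁ 0 ∈ closedSlab L := (add_mem_closedSlab_iff (by simp [pt])).2 hp
  refine ⟨p + n₁ • pt 0 P₁ 0 + n₂ • pt 0 0 P₂, ⟨?_, ?_, ?_⟩, ?_⟩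
  · simpa [pt, closedSlab] using hp
  · have h := hfl (t := p 1) hP₁
    simp [pt]
    exact h
  · have h := hfl (t := p 2) hP₂
    simp [pt]
    exact h
  · rw [shift2 _ _ hp1, shift1 _ _ hp]

lemma closedCell_subset_closedSlab : closedCell L P₁ P₂ ⊆ closedSlab L := fun _ hp => hp.1

lemma isCompact_closedCell : IsCompact (closedCell L P₁ P₂) := by
  convert isCompact_closedBox ![0, 0, 0] ![L, P₁, P₂] using 1
  ext p
  simp [closedCell, Fin.forall_fin_succ]

lemma norm_iteratedFDerivWithin_le_cNorm {V : Type*} [NormedAddCommGroup V] [NormedSpace ℝ V]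
    (hL : 0 < L) {k m : ℕ} (hm : m ≤ k) {u : E3 → V} (hu : ContDiffOn ℝ k u (closedSlab L))
    {p : E3} (hp : p ∈ closedCell L P₁ P₂) :
    ‖iteratedFDerivWithin ℝ m u (closedSlab L) p‖ ≤ cNorm L P₁ P₂ k u := by
  have hcont : ContinuousOn (fun p => ‖iteratedFDerivWithin ℝ m u (closedSlab L) p‖)
      (closedCell L P₁ P₂) :=
    ((hu.continuousOn_iteratedFDerivWithin (by exact_mod_cast hm)
      (uniqueDiffOn_closedSlab hL)).norm).mono closedCell_subset_closedSlab
  have h1 := le_csSup (isCompact_closedCell.bddAbove_image hcont) (mem_image_of_mem _ hp)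
  refine h1.trans ?_
  refine Finset.single_le_sum (f := fun j =>
    sSup ((fun p => ‖iteratedFDerivWithin ℝ j u (closedSlab L) p‖) '' closedCell L P₁ P₂))
    (fun j _ => Real.sSup_nonneg ?_) (Finset.mem_range.2 (by omega))
  rintro _ ⟨q, -, rfl⟩
  exact norm_nonneg _

lemma cNorm_nonneg {V : Type*} [NormedAddCommGroup V] [NormedSpace ℝ V] (k : ℕ) (u : E3 → V) :
    0 ≤ cNorm L P₁ P₂ k u := by
  refine Finset.sum_nonneg fun j _ => Real.sSup_nonneg ?_
  rintro _ ⟨q, -, rfl⟩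
  exact norm_nonneg _

lemma pd_clm_comp {V : Type*} [NormedAddCommGroup V] [NormedSpace ℝ V] (hL : 0 < L) {u : E3 → V}
    (hu : ContDiffOn ℝ 1 u (closedSlab L)) (Λ : V →L[ℝ] ℝ) {p : E3} (hp : p ∈ closedSlab L)
    (j : Fin 3) :
    pd L j (fun q => Λ (u q)) p = Λ (fderivWithin ℝ u (closedSlab L) p (coordVec j)) := by
  have h := Λ.hasFDerivAt.comp_hasFDerivWithinAt p
    ((hu.differentiableOn one_ne_zero) p hp).hasFDerivWithinAt
  have h' := h.fderivWithin (uniqueDiffOn_closedSlab hL p hp)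
  simp only [pd]
  rw [show (fun q => Λ (u q)) = Λ ∘ u from rfl, h']
  rfl

lemma contDiffOn_grad (hL : 0 < L) {f : E3 → ℝ} {n : WithTop ℕ∞}
    (hf : ContDiffOn ℝ (n + 1) f (closedSlab L)) : ContDiffOn ℝ n (grad L f) (closedSlab L) :=
  (InnerProductSpace.toDual ℝ E3).symm.toContinuousLinearEquiv.contDiff.comp_contDiffOn
    (hf.fderivWithin (uniqueDiffOn_closedSlab hL) le_rfl)

/-- If `∇f` is `C²`-close to the constant `a`, then the partial derivatives of `f` are close to the
components of `a`, and the second partial derivatives are close to zero, both in `C¹`. -/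
lemma nearConst_of_cNorm (hL : 0 < L) (hP₁ : 0 < P₁) (hP₂ : 0 < P₂) {f fbar : E3 → ℝ} {a : E3}
    (hf : ContDiffOn ℝ 3 f (closedSlab L)) (hper : PeriodicYZ L P₁ P₂ (grad L f))
    (ha : ∀ p ∈ closedSlab L, grad L fbar p = a) {ε : ℝ}
    (hε : cNorm L P₁ P₂ 2 (fun p => grad L f p - grad L fbar p) ≤ ε) (i : Fin 3) :
    NearConst L P₁ P₂ (a i) ε (pd L i f) ∧
      ∀ j, NearConst L P₁ P₂ 0 ε (pd L j (pd L i f)) := by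
  set u : E3 → E3 := fun p => grad L f p - grad L fbar p with hu
  have hgrad : ContDiffOn ℝ 2 (grad L f) (closedSlab L) :=
    contDiffOn_grad hL (hf.of_le (by norm_num))
  have hu2 : ContDiffOn ℝ 2 u (closedSlab L) :=
    (hgrad.sub contDiffOn_const).congr fun p hp => by rw [hu]; simp only; rw [ha p hp]
  have hu1 : ContDiffOn ℝ 1 u (closedSlab L) := hu2.of_le (by norm_num)
  have hdu1 : ContDiffOn ℝ 1 (fderivWithin ℝ u (closedSlab L)) (closedSlab L) :=
    hu2.fderivWithin (uniqueDiffOn_closedSlab hL) (by norm_num)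
  set π : E3 →L[ℝ] ℝ := EuclideanSpace.proj i with hπ
  have hpi : ∀ x : E3, |π x| ≤ ‖x‖ := fun x => PiLp.norm_apply_le x i
  have hcoord (j : Fin 3) : ‖coordVec j‖ = 1 := by simp
  have p1 : PeriodicYZ L P₁ P₂ (pd L i f) := by
    have := hper.map fun x => x i
    simpa only [grad_apply] using this
  have c2 : ContDiffOn ℝ 2 (pd L i f) (closedSlab L) :=
    contDiffOn_pd hL (hf.of_le (by norm_num))
  have c1 : ContDiffOn ℝ 1 (pd L i f) (closedSlab L) := c2.of_le (by norm_num)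
  have e0 : ∀ p ∈ closedSlab L, pd L i f p - a i = π (u p) := fun p hp => by
    simp [hu, hπ, grad_apply, ← ha p hp]
  have e1 (j : Fin 3) : ∀ p ∈ closedSlab L,
      pd L j (pd L i f) p = π (fderivWithin ℝ u (closedSlab L) p (coordVec j)) := fun p hp => by
    rw [← pd_clm_comp hL hu1 π hp j]
    have h1 : pd L j (fun q => π (u q)) p = pd L j (fun q => pd L i f q - a i) p := by
      rw [pd, pd, fderivWithin_congr (fun q hq => (e0 q hq).symm) (e0 p hp).symm]
    rw [h1, pd_sub hL c1 contDiffOn_const hp, pd_const, sub_zero]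
  have e2 (j k : Fin 3) : ∀ p ∈ closedSlab L, pd L k (pd L j (pd L i f)) p =
      π (fderivWithin ℝ (fderivWithin ℝ u (closedSlab L)) (closedSlab L) p (coordVec k)
        (coordVec j)) := fun p hp => by
    have h1 : pd L k (pd L j (pd L i f)) p = pd L k (fun q =>
        (π.comp (ContinuousLinearMap.apply ℝ E3 (coordVec j)))
          (fderivWithin ℝ u (closedSlab L) q)) p := by
      rw [pd, pd, fderivWithin_congr (fun q hq => e1 j q hq) (e1 j p hp)]
      rfl
    rw [h1, pd_clm_comp hL hdu1 _ hp]
    rfl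
  have n0 : ∀ p ∈ closedCell L P₁ P₂, |pd L i f p - a i| ≤ ε := fun p hp => by
    rw [e0 p hp.1]
    have := norm_iteratedFDerivWithin_le_cNorm (P₁ := P₁) (P₂ := P₂) hL (m := 0) (k := 2)
      (by norm_num) hu2 hp
    rw [norm_iteratedFDerivWithin_zero] at this
    exact (hpi _).trans (this.trans hε)
  have n1 (j : Fin 3) : ∀ p ∈ closedCell L P₁ P₂, |pd L j (pd L i f) p| ≤ ε := fun p hp => by
    rw [e1 j p hp.1]
    have := norm_iteratedFDerivWithin_le_cNorm (P₁ := P₁) (P₂ := P₂) hL (m := 1) (k := 2)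
      (by norm_num) hu2 hp
    rw [norm_iteratedFDerivWithin_one _ (uniqueDiffOn_closedSlab hL p hp.1)] at this
    refine (hpi _).trans (le_trans ?_ (this.trans hε))
    simpa [hcoord] using (fderivWithin ℝ u (closedSlab L) p).le_opNorm (coordVec j)
  have n2 (j k : Fin 3) : ∀ p ∈ closedCell L P₁ P₂, |pd L k (pd L j (pd L i f)) p| ≤ ε :=
      fun p hp => by
    rw [e2 j k p hp.1]
    have := norm_iteratedFDerivWithin_le_cNorm (P₁ := P₁) (P₂ := P₂) hL (m := 2) (k := 2)
      (by norm_num) hu2 hp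
    rw [← norm_iteratedFDerivWithin_fderivWithin (uniqueDiffOn_closedSlab hL) hp.1,
      norm_iteratedFDerivWithin_one _ (uniqueDiffOn_closedSlab hL p hp.1)] at this
    refine (hpi _).trans (le_trans ?_ (this.trans hε))
    set T := fderivWithin ℝ (fderivWithin ℝ u (closedSlab L)) (closedSlab L) p
    have h1 := (T (coordVec k)).le_opNorm (coordVec j)
    have h2 := T.le_opNorm (coordVec k)
    rw [hcoord, mul_one] at h1 h2
    exact h1.trans h2
  have extend {w : E3 → ℝ} {c : ℝ} (hw : PeriodicYZ L P₁ P₂ w)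
      (h : ∀ p ∈ closedCell L P₁ P₂, |w p - c| ≤ ε) : ∀ p ∈ closedSlab L, |w p - c| ≤ ε := by
    intro p hp
    obtain ⟨q, hq, hqp⟩ := hw.exists_closedCell hP₁ hP₂ hp
    rw [← hqp]
    exact h q hq
  have extend0 {w : E3 → ℝ} (hw : PeriodicYZ L P₁ P₂ w)
      (h : ∀ p ∈ closedCell L P₁ P₂, |w p| ≤ ε) : ∀ p ∈ closedSlab L, |w p| ≤ ε := by
    have := extend (c := 0) hw (by simpa using h)
    simpa using this
  refine ⟨⟨c1, p1, extend p1 n0, fun p hp j => extend0 (p1.pd j) (n1 j) p hp⟩, fun j =>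
    ⟨contDiffOn_pd hL (c2.of_le (by norm_num)), p1.pd j, ?_, fun p hp k =>
      extend0 ((p1.pd j).pd k) (n2 j k) p hp⟩⟩
  simpa using extend0 (p1.pd j) (n1 j)

end

section

/-! ### Vector algebra of the integrand -/

lemma cross_apply (a b : E3) (i : Fin 3) :
    cross a b i = a (i + 1) * b (i + 2) - a (i + 2) * b (i + 1) := by
  fin_cases i <;> simp [cross, crossProduct]

lemma dot_eq_sum (a b : E3) : dot a b = ∑ i, a i * b i := by
  simp [dot, PiLp.inner_apply, mul_comm]

lemma dot_self (a : E3) : dot a a = ‖a‖ ^ 2 := real_inner_self_eq_norm_sq a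

lemma cross_zero_apply (a b : E3) : cross a b 0 = a 1 * b 2 - a 2 * b 1 := cross_apply a b 0

lemma cross_one_apply (a b : E3) : cross a b 1 = a 2 * b 0 - a 0 * b 2 := cross_apply a b 1

lemma cross_two_apply (a b : E3) : cross a b 2 = a 0 * b 1 - a 1 * b 0 := cross_apply a b 2

/-- Lagrange's identity. -/
lemma dot_self_mul_dot_self (v Z : E3) :
    dot v v * dot Z Z = dot v Z ^ 2 + dot (cross Z v) (cross Z v) := by
  simp only [dot_eq_sum, Fin.sum_univ_three, cross_zero_apply, cross_one_apply, cross_two_apply]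
  ring

/-- The component of the first variation of the velocity orthogonal to the velocity only involves
the derivatives of `F` and `G` along the velocity. -/
lemma cross_variation (A B P Q : E3) :
    cross (cross P B + cross A Q) (cross A B) =
      dot (cross A B) P • B - dot (cross A B) Q • A := by
  ext i
  fin_cases i <;>
  · simp [dot_eq_sum, Fin.sum_univ_three, cross_zero_apply, cross_one_apply, cross_two_apply]
    ring

lemma dot_self_combination (A B : E3) (s t : ℝ) :
    dot (s • B - t • A) (s • B - t • A) =
      s ^ 2 * dot B B - 2 * s * t * dot A B + t ^ 2 * dot A A := by
  simp only [dot_eq_sum, Fin.sum_univ_three, PiLp.sub_apply, PiLp.smul_apply, smul_eq_mul]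
  ring

lemma dot_cross_variation (A B P Q v : E3) :
    dot v (cross P B + cross A Q) = dot (cross B v) P + dot (cross v A) Q := by
  simp only [dot_eq_sum, Fin.sum_univ_three, PiLp.add_apply, cross_zero_apply, cross_one_apply,
    cross_two_apply]
  ring

lemma cross_dot_cross (A B : E3) :
    dot (cross A B) (cross A B) = dot A A * dot B B - dot A B ^ 2 := by
  simp only [dot_eq_sum, Fin.sum_univ_three, cross_zero_apply, cross_one_apply, cross_two_apply]
  ring

/-- Expansion of `w` in the basis `B × v`, `v × A`, `v`, where `v = A × B`. -/
lemma dot_basis_expansion (A B w Q : E3) :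
    dot (cross A B) (cross A B) * dot w Q =
      dot w A * dot (cross B (cross A B)) Q + dot w B * dot (cross (cross A B) A) Q +
        dot w (cross A B) * dot (cross A B) Q := by
  simp only [dot_eq_sum, Fin.sum_univ_three, cross_zero_apply, cross_one_apply, cross_two_apply]
  ring

/-- The hypothesis on `(a, b)` says that the Gram matrix of `(a, b)` has eigenvalues at most one.
Its determinant is `|a × b|²`, so its eigenvalues are at least `|a × b|²`. -/
lemma gram_lower_bound {a b : E3} (hnorm : ‖a‖ ^ 2 + ‖b‖ ^ 2
      + √((‖a‖ ^ 2 + ‖b‖ ^ 2) ^ 2 - 4 * ‖cross a b‖ ^ 2) ≤ 2) :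
    dot (cross a b) (cross a b) ≤ 1 ∧ ∀ s t : ℝ, dot (cross a b) (cross a b) * (s ^ 2 + t ^ 2) ≤
      s ^ 2 * dot b b - 2 * s * t * dot a b + t ^ 2 * dot a a := by
  have hdet := cross_dot_cross a b
  rw [← dot_self, ← dot_self, ← dot_self] at hnorm
  have hx : 0 ≤ dot a a := by rw [dot_self]; positivity
  have hy : 0 ≤ dot b b := by rw [dot_self]; positivity
  have hr : 0 ≤ dot (cross a b) (cross a b) := by rw [dot_self]; positivity
  generalize dot (cross a b) (cross a b) = ρ at *
  generalize dot a a = x at *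
  generalize dot b b = y at *
  generalize dot a b = z at *
  have hdisc : 0 ≤ (x + y) ^ 2 - 4 * ρ := by rw [hdet]; nlinarith [sq_nonneg (x - y), sq_nonneg z]
  have hs := Real.sqrt_nonneg ((x + y) ^ 2 - 4 * ρ)
  have hs2 := Real.sq_sqrt hdisc
  set σ := √((x + y) ^ 2 - 4 * ρ)
  have hτ : x + y ≤ 2 := by linarith
  have hone : x + y ≤ 1 + ρ := by nlinarith
  have hρ1 : ρ ≤ 1 := by nlinarith
  refine ⟨hρ1, fun s t => ?_⟩
  -- The symmetric matrix with entries `y - ρ`, `-z`, `x - ρ` has nonnegative trace and determinant.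
  have htr : 0 ≤ (x - ρ) + (y - ρ) := by nlinarith
  have hdet' : 0 ≤ (x - ρ) * (y - ρ) - z ^ 2 := by
    have : (x - ρ) * (y - ρ) - z ^ 2 = ρ * (1 + ρ - (x + y)) := by
      linear_combination (-1 : ℝ) * hdet
    rw [this]
    exact mul_nonneg hr (by linarith)
  have hxρ : 0 ≤ x - ρ := by
    by_contra h
    push Not at h
    nlinarith [sq_nonneg z]
  have hyρ : 0 ≤ y - ρ := by
    by_contra h
    push Not at h
    nlinarith [sq_nonneg z]
  have key : 0 ≤ (y - ρ) * s ^ 2 - 2 * z * s * t + (x - ρ) * t ^ 2 := by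
    rcases hyρ.eq_or_lt with h0 | hpos
    · have hz : z = 0 := by
        rw [← h0] at hdet'
        have : z ^ 2 ≤ 0 := by linarith
        exact pow_eq_zero_iff (two_ne_zero) |>.1 (le_antisymm this (sq_nonneg z))
      rw [← h0, hz]
      have := mul_nonneg hxρ (sq_nonneg t)
      linarith
    · have h2 : 0 ≤ (y - ρ) * ((y - ρ) * s ^ 2 - 2 * z * s * t + (x - ρ) * t ^ 2) := by
        have : (y - ρ) * ((y - ρ) * s ^ 2 - 2 * z * s * t + (x - ρ) * t ^ 2) =
            ((y - ρ) * s - z * t) ^ 2 + ((x - ρ) * (y - ρ) - z ^ 2) * t ^ 2 := by ring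
        rw [this]
        positivity
      exact nonneg_of_mul_nonneg_right h2 hpos
  linarith

/-- Near `(a, b)`, the first variation of the velocity controls the divergence-like quantity
`v · (∇F × B + A × ∇G)` and, with a factor close to one, the derivatives along the velocity. -/
lemma variation_lower_bound {a b A B P Q : E3} {η : ℝ} (hη1 : η ≤ 1)
    (hη : 100 * η ≤ dot (cross a b) (cross a b)) (hρ : dot (cross a b) (cross a b) ≤ 1)
    (hgram : ∀ s t : ℝ, dot (cross a b) (cross a b) * (s ^ 2 + t ^ 2) ≤
      s ^ 2 * dot b b - 2 * s * t * dot a b + t ^ 2 * dot a a)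
    (hpos : 0 < dot (cross A B) (cross A B))
    (hAA : |dot A A - dot a a| ≤ η) (hBB : |dot B B - dot b b| ≤ η) (hAB : |dot A B - dot a b| ≤ η)
    (hvv : |dot (cross A B) (cross A B) - dot (cross a b) (cross a b)| ≤ η) :
    dot (cross A B) (cross P B + cross A Q) ^ 2 / 2 +
      31 / 32 * (dot (cross A B) P ^ 2 + dot (cross A B) Q ^ 2) ≤
      dot (cross P B + cross A Q) (cross P B + cross A Q) := by
  have h1 := dot_self_mul_dot_self (cross A B) (cross P B + cross A Q)
  rw [cross_variation, dot_self_combination] at h1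
  generalize dot (cross A B) (cross A B) = r at *
  generalize dot (cross P B + cross A Q) (cross P B + cross A Q) = Z at *
  generalize dot (cross A B) (cross P B + cross A Q) = D at *
  generalize dot (cross A B) P = s at *
  generalize dot (cross A B) Q = t at *
  generalize dot (cross a b) (cross a b) = ρ at *
  have hg := hgram s t
  rw [abs_le] at hAA hBB hAB hvv
  have e1 : s ^ 2 * dot B B ≥ s ^ 2 * (dot b b - η) :=
    mul_le_mul_of_nonneg_left (by linarith) (sq_nonneg s)
  have e2 : t ^ 2 * dot A A ≥ t ^ 2 * (dot a a - η) :=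
    mul_le_mul_of_nonneg_left (by linarith) (sq_nonneg t)
  have e3 : 2 * s * t * (dot A B - dot a b) ≤ η * (s ^ 2 + t ^ 2) := by
    have hη0 : 0 ≤ η := by linarith [hAB.1, hAB.2]
    have hst : |2 * s * t| ≤ s ^ 2 + t ^ 2 :=
      abs_le.2 ⟨by nlinarith [sq_nonneg (s + t)], by nlinarith [sq_nonneg (s - t)]⟩
    calc 2 * s * t * (dot A B - dot a b) ≤ |2 * s * t * (dot A B - dot a b)| := le_abs_self _
      _ = |2 * s * t| * |dot A B - dot a b| := abs_mul _ _
      _ ≤ (s ^ 2 + t ^ 2) * η := by gcongr; exact abs_le.2 hAB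
      _ = η * (s ^ 2 + t ^ 2) := mul_comm _ _
  have hstn : 0 ≤ s ^ 2 + t ^ 2 := by positivity
  have e4 : s ^ 2 * dot B B - 2 * s * t * dot A B + t ^ 2 * dot A A ≥
      (ρ - 2 * η) * (s ^ 2 + t ^ 2) := by nlinarith
  have e5 : (ρ - 2 * η) * (s ^ 2 + t ^ 2) ≥ 31 / 32 * r * (s ^ 2 + t ^ 2) :=
    mul_le_mul_of_nonneg_right (by linarith) hstn
  have hr2 : r ≤ 2 := by linarith
  have e6 : r * (D ^ 2 / 2) ≤ D ^ 2 := by nlinarith [sq_nonneg D]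
  have : r * (D ^ 2 / 2 + 31 / 32 * (s ^ 2 + t ^ 2)) ≤ r * Z := by
    rw [h1]
    nlinarith
  exact le_of_mul_le_mul_left this hpos

lemma two_mul_le_of_abs {ε c x y : ℝ} (hc : |c| ≤ ε) : -(ε * (x ^ 2 + y ^ 2)) ≤ 2 * c * x * y := by
  have h1 : |2 * x * y| ≤ x ^ 2 + y ^ 2 :=
    abs_le.2 ⟨by nlinarith [sq_nonneg (x + y)], by nlinarith [sq_nonneg (x - y)]⟩
  have h2 : |2 * c * x * y| ≤ ε * (x ^ 2 + y ^ 2) := by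
    have : 2 * c * x * y = c * (2 * x * y) := by ring
    rw [this, abs_mul]
    gcongr
    exact (abs_nonneg c).trans hc
  exact (abs_le.1 h2).1

/-- The final pointwise estimate: the coercive terms absorb the small ones. The weight `7/8` is
spent on the Poincaré inequality and `1/32` on absorbing the small terms. -/
lemma absorb_small_terms {ε κ R D s t F G c₁ c₂ c₃ dX dY dX' qd q Z : ℝ} (hε : ε ≤ 1 / 32)
    (hZ : D ^ 2 / 2 + 31 / 32 * (s ^ 2 + t ^ 2) ≤ Z)
    (h1 : |c₁| ≤ ε) (h2 : |c₂| ≤ ε) (h3 : |c₃| ≤ ε) (hX : |dX| ≤ ε) (hY : |dY| ≤ ε)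
    (hX' : |dX'| ≤ ε) (hq : κ - ε ≤ -(qd + q ^ 2)) (hR : R ≤ 7 / 8 * κ - 5 * ε) :
    1 / 16 * s ^ 2 + 1 / 16 * t ^ 2 + R * (F ^ 2 + G ^ 2) ≤
      Z - 2 * dX * F * G - 2 * c₁ * G * D - dY * G ^ 2 + 2 * c₂ * F * D + dX' * F ^ 2
        + 2 * c₃ * F * t - 7 / 8 * (qd * F ^ 2 + 2 * q * F * s)
        - 7 / 8 * (qd * G ^ 2 + 2 * q * G * t) := by
  have a1 := two_mul_le_of_abs (x := F) (y := G) (c := -dX) (by simpa using hX)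
  have a2 := two_mul_le_of_abs (x := G) (y := D) (c := -c₁) (by simpa using h1)
  have a3 := two_mul_le_of_abs (x := F) (y := D) h2
  have a4 := two_mul_le_of_abs (x := F) (y := t) h3
  have a5 : dY * G ^ 2 ≤ ε * G ^ 2 := mul_le_mul_of_nonneg_right (abs_le.1 hY).2 (sq_nonneg G)
  have a6 : -ε * F ^ 2 ≤ dX' * F ^ 2 := mul_le_mul_of_nonneg_right (abs_le.1 hX').1 (sq_nonneg F)
  have b1 : (κ - ε) * F ^ 2 ≤ -(qd + q ^ 2) * F ^ 2 := mul_le_mul_of_nonneg_right hq (sq_nonneg F)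
  have b2 : (κ - ε) * G ^ 2 ≤ -(qd + q ^ 2) * G ^ 2 := mul_le_mul_of_nonneg_right hq (sq_nonneg G)
  have b3 := sq_nonneg (s - q * F)
  have b4 := sq_nonneg (t - q * G)
  have b5 : R * (F ^ 2 + G ^ 2) ≤ (7 / 8 * κ - 5 * ε) * (F ^ 2 + G ^ 2) :=
    mul_le_mul_of_nonneg_right hR (by positivity)
  have b6 : 0 ≤ (1 / 32 - ε) * D ^ 2 := mul_nonneg (by linarith) (sq_nonneg D)
  have b7 : 0 ≤ (1 / 32 - ε) * t ^ 2 := mul_nonneg (by linarith) (sq_nonneg t)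
  have hε0 : 0 ≤ ε := (abs_nonneg _).trans h1
  have b8 : 0 ≤ ε * F ^ 2 := by positivity
  have b9 : 0 ≤ ε * G ^ 2 := by positivity
  nlinarith [sq_nonneg D, sq_nonneg s]

end

section

/-! ### Divergence and curl identities for periodic vector fields -/

variable {L P₁ P₂ : ℝ} {F G : E3 → ℝ} {DF DG : E3 → E3}

/-- The divergence of a vector field on the closed slab. -/
noncomputable def vdiv (L : ℝ) (X : E3 → E3) (p : E3) : ℝ := ∑ j, pd L j (fun q => X q j) p

/-- The curl of a vector field on the closed slab; indices are taken modulo three. -/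
noncomputable def vcurl (L : ℝ) (X : E3 → E3) (p : E3) : E3 :=
  WithLp.toLp 2 fun i =>
    pd L (i + 1) (fun q => X q (i + 2)) p - pd L (i + 2) (fun q => X q (i + 1)) p

/-- A periodic vector field of class `C¹` on the closed slab. -/
structure PeriodicC1Field (L P₁ P₂ : ℝ) (X : E3 → E3) : Prop where
  contDiff : ∀ j, ContDiffOn ℝ 1 (fun p => X p j) (closedSlab L)
  periodic : ∀ j, PeriodicYZ L P₁ P₂ fun p => X p j

lemma dot_smul_left (c : ℝ) (a b : E3) : dot (c • a) b = c * dot a b := real_inner_smul_left a b c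

lemma integral_sum_eq_zero {α : Type*} [MeasurableSpace α] {μ : Measure α} {N : Fin 3 → α → ℝ}
    (h : ∀ i, Integrable (N i) μ ∧ ∫ x, N i x ∂μ = 0) :
    Integrable (fun x => ∑ i, N i x) μ ∧ ∫ x, ∑ i, N i x ∂μ = 0 := by
  refine ⟨integrable_finsetSum _ fun i _ => (h i).1, ?_⟩
  rw [integral_finsetSum _ fun i _ => (h i).1]
  exact Finset.sum_eq_zero fun i _ => (h i).2

lemma AdmissibleVariation.integral_cell_vdiv (hL : 0 < L) (hP₁ : 0 < P₁) (hP₂ : 0 < P₂)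
    (hF : AdmissibleVariation L P₁ P₂ F DF) (hG : AdmissibleVariation L P₁ P₂ G DG) {X : E3 → E3}
    (hX : PeriodicC1Field L P₁ P₂ X) :
    IntegrableOn (fun p => vdiv L X p * F p * G p +
      (F p * dot (X p) (DG p) + G p * dot (X p) (DF p))) (cell L P₁ P₂) ∧
    ∫ p in cell L P₁ P₂, (vdiv L X p * F p * G p +
      (F p * dot (X p) (DG p) + G p * dot (X p) (DF p))) = 0 := by
  have h := integral_sum_eq_zero fun j =>
    hF.integral_cell_product_rule hL hP₁ hP₂ hG (hX.contDiff j) (hX.periodic j) j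
  refine ⟨h.1.congr (Eventually.of_forall fun p => ?_), ?_⟩
  · simp only [vdiv, dot_eq_sum, Fin.sum_univ_three]
    ring
  · rw [← h.2]
    congr 1
    ext p
    simp only [vdiv, dot_eq_sum, Fin.sum_univ_three]
    ring

lemma AdmissibleVariation.integral_cell_vcurl (hL : 0 < L) (hP₁ : 0 < P₁) (hP₂ : 0 < P₂)
    (hF : AdmissibleVariation L P₁ P₂ F DF) (hG : AdmissibleVariation L P₁ P₂ G DG) {X : E3 → E3}
    (hX : PeriodicC1Field L P₁ P₂ X) :
    IntegrableOn (fun p => dot (X p) (cross (DF p) (DG p)) - F p * dot (vcurl L X p) (DG p))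
      (cell L P₁ P₂) ∧
    ∫ p in cell L P₁ P₂, (dot (X p) (cross (DF p) (DG p)) - F p * dot (vcurl L X p) (DG p))
      = 0 := by
  have fin_three_add : (0 : Fin 3) + 1 = 1 ∧ (1 : Fin 3) + 1 = 2 ∧ (2 : Fin 3) + 1 = 0 ∧
    (0 : Fin 3) + 2 = 2 ∧ (1 : Fin 3) + 2 = 0 ∧ (2 : Fin 3) + 2 = 1 := by decide
  have h := integral_sum_eq_zero fun i =>
    hF.integral_cell_minor hL hP₁ hP₂ hG (hX.contDiff i) (hX.periodic i) (i + 1) (i + 2)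
  refine ⟨h.1.congr (Eventually.of_forall fun p => ?_), ?_⟩
  · simp only [vcurl, dot_eq_sum, Fin.sum_univ_three, cross_zero_apply, cross_one_apply,
      cross_two_apply, fin_three_add]
    ring
  · rw [← h.2]
    congr 1
    ext p
    simp only [vcurl, dot_eq_sum, Fin.sum_univ_three, cross_zero_apply, cross_one_apply,
      cross_two_apply, fin_three_add]
    ring

lemma memLp_dot {X : E3 → E3} (hX : ∀ j, ContinuousOn (fun p => X p j) (closedSlab L))
    {W : E3 → E3} (hW : ∀ j, MemLp (fun p => W p j) 2 (volume.restrict (box L P₁ P₂))) :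
    MemLp (fun p => dot (X p) (W p)) 2 (volume.restrict (box L P₁ P₂)) := by
  simp only [dot_eq_sum]
  exact memLp_finsetSum _ fun j _ => memLp_mul_of_continuousOn (hX j) (hW j)

lemma continuous_hess {H : ℝ × ℝ → ℝ} (hH : ContDiff ℝ 2 H) : Continuous (hess H) :=
  ((hH.fderiv_right (m := 1) (by norm_num)).continuous_fderiv (by norm_num))

/-- The integral inequality, once the coefficients satisfy the smallness conditions under which the
coercive terms dominate pointwise. Integrands with vanishing integral are added to the quadratic
form so that the inequality holds pointwise. -/
lemma secondVariation_ge_of_pointwise (hL : 0 < L) (hP₁ : 0 < P₁) (hP₂ : 0 < P₂) {f g : E3 → ℝ}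
    (hfg : AdmissiblePair L P₁ P₂ f g) {H : ℝ × ℝ → ℝ} (hH : AdmissibleH L P₁ P₂ f g H)
    (hF : AdmissibleVariation L P₁ P₂ F DF) (hG : AdmissibleVariation L P₁ P₂ G DG)
    {c₁ c₂ c₃ q : E3 → ℝ} {ε κ R : ℝ}
    (hV : PeriodicC1Field L P₁ P₂ (velocity L f g))
    (hX : PeriodicC1Field L P₁ P₂ fun p => c₁ p • cross (grad L g p) (velocity L f g p))
    (hX' : PeriodicC1Field L P₁ P₂ fun p => c₂ p • cross (grad L g p) (velocity L f g p))
    (hY : PeriodicC1Field L P₁ P₂ fun p => c₁ p • cross (velocity L f g p) (grad L f p))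
    (hq : PeriodicC1Field L P₁ P₂ fun p => q p • velocity L f g p)
    (hcurl : ∀ p ∈ closedSlab L, ∀ Q, dot (vcurl L (velocity L f g) p) Q =
      c₁ p * dot (cross (grad L g p) (velocity L f g p)) Q +
      c₂ p * dot (cross (velocity L f g p) (grad L f p)) Q + c₃ p * dot (velocity L f g p) Q)
    (hε : ε ≤ 1 / 32) (hR : R ≤ 7 / 8 * κ - 5 * ε)
    (hZ : ∀ p ∈ closedSlab L, ∀ P Q : E3,
      dot (velocity L f g p) (cross P (grad L g p) + cross (grad L f p) Q) ^ 2 / 2 +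
      31 / 32 * (dot (velocity L f g p) P ^ 2 + dot (velocity L f g p) Q ^ 2) ≤
      dot (cross P (grad L g p) + cross (grad L f p) Q)
        (cross P (grad L g p) + cross (grad L f p) Q))
    (h₁ : ∀ p ∈ closedSlab L, |c₁ p| ≤ ε) (h₂ : ∀ p ∈ closedSlab L, |c₂ p| ≤ ε)
    (h₃ : ∀ p ∈ closedSlab L, |c₃ p| ≤ ε)
    (hdX : ∀ p ∈ closedSlab L,
      |vdiv L (fun p => c₁ p • cross (grad L g p) (velocity L f g p)) p| ≤ ε)
    (hdX' : ∀ p ∈ closedSlab L,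
      |vdiv L (fun p => c₂ p • cross (grad L g p) (velocity L f g p)) p| ≤ ε)
    (hdY : ∀ p ∈ closedSlab L,
      |vdiv L (fun p => c₁ p • cross (velocity L f g p) (grad L f p)) p| ≤ ε)
    (hdq : ∀ p ∈ closedSlab L,
      κ - ε ≤ -(vdiv L (fun p => q p • velocity L f g p) p + q p ^ 2)) :
    ∫ p in cell L P₁ P₂,
      ((1 / 16 : ℝ) * (dot (velocity L f g p) (DF p)) ^ 2
        + (1 / 16 : ℝ) * (dot (velocity L f g p) (DG p)) ^ 2 + R * (F p ^ 2 + G p ^ 2)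
        + Hff H (f p, g p) * F p ^ 2 + 2 * Hfg H (f p, g p) * (F p * G p)
        + Hgg H (f p, g p) * G p ^ 2) ≤
      secondVariation L P₁ P₂ H f g F DF G DG F DF G DG := by
  have mF := hF.memLp_box P₁ P₂
  have mG := hG.memLp_box P₁ P₂
  have mDF (i : Fin 3) := hF.memLp_grad_box P₁ P₂ i
  have mDG (i : Fin 3) := hG.memLp_grad_box P₁ P₂ i
  have mγ := memLp_dot (fun j => (hV.contDiff j).continuousOn) mDF
  have mγ' := memLp_dot (fun j => (hV.contDiff j).continuousOn) mDG
  have cgrad {u : E3 → ℝ} (hu : ContDiffOn ℝ 3 u (closedSlab L)) (j : Fin 3) :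
      ContinuousOn (fun p => grad L u p j) (closedSlab L) := by
    simp only [grad_apply]
    exact continuousOn_pd hL (hu.of_le (by norm_num))
  have cf := cgrad hfg.contDiff_fst
  have cg := cgrad hfg.contDiff_snd
  have mZ (i : Fin 3) : MemLp (fun p =>
      (cross (DF p) (grad L g p) + cross (grad L f p) (DG p)) i) 2
      (volume.restrict (box L P₁ P₂)) := by
    have h := (((memLp_mul_of_continuousOn (cg (i + 2)) (mDF (i + 1))).sub
      (memLp_mul_of_continuousOn (cg (i + 1)) (mDF (i + 2)))).add
      ((memLp_mul_of_continuousOn (cf (i + 1)) (mDG (i + 2))).sub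
      (memLp_mul_of_continuousOn (cf (i + 2)) (mDG (i + 1)))))
    convert h using 1
    ext p
    simp only [PiLp.add_apply, cross_apply, Pi.add_apply, Pi.sub_apply]
    ring
  have cH (a b : ℝ × ℝ) : ContinuousOn (fun p => hess H (f p, g p) a b) (closedSlab L) := by
    have h : ContinuousOn (fun p => hess H (f p, g p)) (closedSlab L) :=
      (continuous_hess hH.contDiff).comp_continuousOn
        (hfg.contDiff_fst.continuousOn.prodMk hfg.contDiff_snd.continuousOn)
    exact (h.clm_apply continuousOn_const).clm_apply continuousOn_const
  have toCell {T : E3 → ℝ} (h : Integrable T (volume.restrict (box L P₁ P₂))) :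
      IntegrableOn T (cell L P₁ P₂) := IntegrableOn.mono_set h (cell_subset_box hP₁ hP₂)
  have iH : IntegrableOn (fun p => Hff H (f p, g p) * F p * F p
      + 2 * (Hfg H (f p, g p) * F p * G p) + Hgg H (f p, g p) * G p * G p) (cell L P₁ P₂) :=
    ((toCell (integrable_mul_of_L2 (memLp_mul_of_continuousOn (cH _ _) mF) mF)).add
      ((toCell (integrable_mul_of_L2 (memLp_mul_of_continuousOn (cH _ _) mF) mG)).const_mul 2)).add
      (toCell (integrable_mul_of_L2 (memLp_mul_of_continuousOn (cH _ _) mG) mG))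
  have iZ : IntegrableOn (fun p => dot (cross (DF p) (grad L g p) + cross (grad L f p) (DG p))
      (cross (DF p) (grad L g p) + cross (grad L f p) (DG p))) (cell L P₁ P₂) := by
    simp only [dot_eq_sum]
    exact toCell (integrable_finsetSum _ fun i _ => integrable_mul_of_L2 (mZ i) (mZ i))
  have iN : IntegrableOn (fun p => dot (velocity L f g p) (cross (DF p) (DG p)))
      (cell L P₁ P₂) := by
    have h (i : Fin 3) : Integrable (fun p => velocity L f g p i * cross (DF p) (DG p) i)
        (volume.restrict (box L P₁ P₂)) := by
      have cV := (hV.contDiff i).continuousOn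
      have := (integrable_mul_of_L2 (memLp_mul_of_continuousOn cV (mDF (i + 1)))
        (mDG (i + 2))).sub (integrable_mul_of_L2 (memLp_mul_of_continuousOn cV (mDF (i + 2)))
        (mDG (i + 1)))
      convert this using 1
      ext p
      simp only [cross_apply, Pi.sub_apply]
      ring
    simp only [dot_eq_sum]
    exact toCell (integrable_finsetSum _ fun i _ => h i)
  have iL : IntegrableOn (fun p => dot (cross (DF p) (grad L g p) + cross (grad L f p) (DG p))
        (cross (DF p) (grad L g p) + cross (grad L f p) (DG p))
      + dot (velocity L f g p) (cross (DF p) (DG p))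
      + dot (velocity L f g p) (cross (DF p) (DG p))
      + Hff H (f p, g p) * (F p * F p)
      + Hfg H (f p, g p) * (F p * G p + G p * F p)
      + Hgg H (f p, g p) * (G p * G p)) (cell L P₁ P₂) := by
    refine (((iZ.add iN).add iN).add iH).congr_fun (fun p _ => ?_) (measurableSet_cell L P₁ P₂)
    simp only [Pi.add_apply]
    ring
  have iR : IntegrableOn (fun p => (1 / 16 : ℝ) * (dot (velocity L f g p) (DF p)) ^ 2
        + (1 / 16 : ℝ) * (dot (velocity L f g p) (DG p)) ^ 2 + R * (F p ^ 2 + G p ^ 2)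
        + Hff H (f p, g p) * F p ^ 2 + 2 * Hfg H (f p, g p) * (F p * G p)
        + Hgg H (f p, g p) * G p ^ 2) (cell L P₁ P₂) := by
    refine IntegrableOn.congr_fun (((((toCell (integrable_mul_of_L2 mγ mγ)).const_mul (1 / 16)).add
      ((toCell (integrable_mul_of_L2 mγ' mγ')).const_mul (1 / 16))).add
      (((toCell (integrable_mul_of_L2 mF mF)).add
        (toCell (integrable_mul_of_L2 mG mG))).const_mul R)).add iH)
      (fun p _ => ?_) (measurableSet_cell L P₁ P₂)
    simp only [Pi.add_apply]
    ring
  -- The six integrands with vanishing integral: the null Lagrangian, the three integrations by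
  -- parts that remove `∇G` from `F w · ∇G`, and the Poincaré identity for `F` and for `G`.
  obtain ⟨n1, z1⟩ := hF.integral_cell_vcurl hL hP₁ hP₂ hG hV
  obtain ⟨n2, z2⟩ := hF.integral_cell_vdiv hL hP₁ hP₂ hG hX
  obtain ⟨n3, z3⟩ := hF.integral_cell_vdiv hL hP₁ hP₂ hF hX'
  obtain ⟨n4, z4⟩ := hG.integral_cell_vdiv hL hP₁ hP₂ hG hY
  obtain ⟨n5, z5⟩ := hF.integral_cell_vdiv hL hP₁ hP₂ hF hq
  obtain ⟨n6, z6⟩ := hG.integral_cell_vdiv hL hP₁ hP₂ hG hq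
  have m1 := (n1.const_mul 2).add (n2.const_mul 2)
  have m2 := n4.sub n3
  have m3 := (n5.add n6).const_mul (7 / 8 : ℝ)
  have hM0 := integral_add (m1.add m2) m3
  have hM1 := integral_add m1 m2
  have hM2 := integral_add (n1.const_mul 2) (n2.const_mul 2)
  have hM3 := integral_sub n4 n3
  have hM4 := integral_add n5 n6
  rw [integral_const_mul, integral_const_mul, z1, z2] at hM2
  rw [z4, z3] at hM3
  rw [z5, z6] at hM4
  simp only [Pi.add_apply, Pi.sub_apply, integral_const_mul] at hM0 hM1 hM2 hM3 hM4
  rw [hM1, hM2, hM3, hM4] at hM0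
  have hsum := integral_add iR ((m1.add m2).add m3)
  simp only [Pi.add_apply, Pi.sub_apply] at hsum
  rw [hM0] at hsum
  have hmono := setIntegral_mono_on (iR.add ((m1.add m2).add m3)) iL (measurableSet_cell L P₁ P₂)
    (fun p hp => ?_)
  · simp only [Pi.add_apply, Pi.sub_apply] at hmono
    rw [hsum] at hmono
    rw [secondVariation]
    linarith
  have hp' : p ∈ closedSlab L := slab_subset_closedSlab L hp.1
  have key := absorb_small_terms (F := F p) (G := G p) hε (hZ p hp' (DF p) (DG p)) (h₁ p hp')
    (h₂ p hp') (h₃ p hp') (hdX p hp') (hdY p hp') (hdX' p hp') (hdq p hp') hR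
  have hD := dot_cross_variation (grad L f p) (grad L g p) (DF p) (DG p) (velocity L f g p)
  rw [hD] at key
  simp only [Pi.add_apply, Pi.sub_apply, hcurl p hp' (DG p), dot_smul_left]
  linear_combination key

end

section

/-! ### Vector fields that are `C¹`-close to constants -/

variable {L P₁ P₂ : ℝ} {ι : Type*} {l : Filter ι} {c d : E3} {X Y : ι → E3 → E3}

/-- Componentwise convergence of a family of vector fields to a constant, in the sense of
`TendsC1`. -/
def TendsVec1 (l : Filter ι) (L P₁ P₂ : ℝ) (c : E3) (X : ι → E3 → E3) : Prop :=
  ∀ i, TendsC1 l L P₁ P₂ (c i) fun k p => X k p i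

/-- Componentwise convergence of a family of vector fields to a constant, in the sense of
`TendsC2`. -/
def TendsVec2 (l : Filter ι) (L P₁ P₂ : ℝ) (c : E3) (X : ι → E3 → E3) : Prop :=
  ∀ i, TendsC2 l L P₁ P₂ (c i) fun k p => X k p i

lemma TendsVec2.toVec1 (hX : TendsVec2 l L P₁ P₂ c X) : TendsVec1 l L P₁ P₂ c X :=
  fun i => (hX i).1

lemma TendsVec2.cross (hL : 0 < L) (hX : TendsVec2 l L P₁ P₂ c X) (hY : TendsVec2 l L P₁ P₂ d Y) :
    TendsVec2 l L P₁ P₂ (cross c d) fun k p => cross (X k p) (Y k p) := fun i => by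
  simp only [cross_apply]
  exact ((hX _).mul hL (hY _)).sub hL ((hX _).mul hL (hY _))

lemma TendsVec1.cross (hL : 0 < L) (hX : TendsVec1 l L P₁ P₂ c X) (hY : TendsVec1 l L P₁ P₂ d Y) :
    TendsVec1 l L P₁ P₂ (cross c d) fun k p => cross (X k p) (Y k p) := fun i => by
  simp only [cross_apply]
  exact ((hX _).mul hL (hY _)).sub hL ((hX _).mul hL (hY _))

lemma TendsVec1.dot (hL : 0 < L) (hX : TendsVec1 l L P₁ P₂ c X) (hY : TendsVec1 l L P₁ P₂ d Y) :
    TendsC1 l L P₁ P₂ (dot c d) fun k p => dot (X k p) (Y k p) := by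
  simp only [dot_eq_sum, Fin.sum_univ_three]
  exact (((hX 0).mul hL (hY 0)).add hL ((hX 1).mul hL (hY 1))).add hL ((hX 2).mul hL (hY 2))

lemma TendsVec1.smul_zero (hL : 0 < L) {u : ι → E3 → ℝ} (hu : TendsC1 l L P₁ P₂ 0 u)
    (hX : TendsVec1 l L P₁ P₂ c X) :
    TendsVec1 l L P₁ P₂ 0 fun k p => u k p • X k p := fun i => by
  simp only [PiLp.smul_apply, smul_eq_mul]
  exact (hu.mul hL (hX i)).of_eq (by simp)

lemma TendsVec2.tendsVec1_vcurl (hL : 0 < L) (hX : TendsVec2 l L P₁ P₂ c X) :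
    TendsVec1 l L P₁ P₂ 0 fun k => vcurl L (X k) := fun i =>
  (((hX (i + 2)).2 (i + 1)).sub hL ((hX (i + 1)).2 (i + 2))).of_eq (by simp)

lemma TendsVec1.abs_vdiv_le (hX : TendsVec1 l L P₁ P₂ c X) {ε : ℝ} (hε : 0 < ε) :
    ∀ᶠ k in l, ∀ p ∈ closedSlab L, |vdiv L (X k) p| ≤ ε := by
  have h : ∀ᶠ k in l, ∀ i, NearConst L P₁ P₂ (c i) (ε / 3) fun p => X k p i :=
    eventually_all.2 fun i => hX i (ε / 3) (by linarith)
  filter_upwards [h] with k hk p hp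
  calc |vdiv L (X k) p| ≤ ∑ j, |pd L j (fun q => X k q j) p| := Finset.abs_sum_le_sum_abs _ _
    _ ≤ ∑ _j : Fin 3, ε / 3 := Finset.sum_le_sum fun j _ => (hk j).deriv p hp j
    _ = ε := by simp; ring

lemma TendsVec1.periodicC1Field (hX : TendsVec1 l L P₁ P₂ c X) :
    ∀ᶠ k in l, PeriodicC1Field L P₁ P₂ (X k) := by
  have h : ∀ᶠ k in l, ∀ i, NearConst L P₁ P₂ (c i) 1 fun p => X k p i :=
    eventually_all.2 fun i => hX i 1 one_pos
  filter_upwards [h] with k hk using ⟨fun i => (hk i).contDiff, fun i => (hk i).periodic⟩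

lemma TendsC1.abs_sub_le {c : ℝ} {u : ι → E3 → ℝ} (hu : TendsC1 l L P₁ P₂ c u) {ε : ℝ}
    (hε : 0 < ε) : ∀ᶠ k in l, ∀ p ∈ closedSlab L, |u k p - c| ≤ ε :=
  (hu ε hε).mono fun _ h => h.value

lemma TendsC1.abs_le {u : ι → E3 → ℝ} (hu : TendsC1 l L P₁ P₂ 0 u) {ε : ℝ}
    (hε : 0 < ε) : ∀ᶠ k in l, ∀ p ∈ closedSlab L, |u k p| ≤ ε := by
  simpa using hu.abs_sub_le hε

end

section

/-! ### Pairs near the reference pair -/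

/-- The filter of admissible pairs `(f, g)` whose gradients tend to those of the reference pair
in `C²` of the closed cell. -/
noncomputable def nearbyPairs (L P₁ P₂ : ℝ) (fbar gbar : E3 → ℝ) : Filter ((E3 → ℝ) × (E3 → ℝ)) :=
  comap (fun fg => cNorm L P₁ P₂ 2 (fun p => grad L fg.1 p - grad L fbar p)
      + cNorm L P₁ P₂ 2 (fun p => grad L fg.2 p - grad L gbar p)) (𝓝 0) ⊓
    𝓟 {fg | AdmissiblePair L P₁ P₂ fg.1 fg.2}

variable {L P₁ P₂ : ℝ} {fbar gbar : E3 → ℝ} {a b : E3}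

lemma exists_delta_of_eventually {p : (E3 → ℝ) × (E3 → ℝ) → Prop}
    (h : ∀ᶠ fg in nearbyPairs L P₁ P₂ fbar gbar, p fg) :
    ∃ δ > 0, ∀ f g : E3 → ℝ, AdmissiblePair L P₁ P₂ f g →
      cNorm L P₁ P₂ 2 (fun p => grad L f p - grad L fbar p)
        + cNorm L P₁ P₂ 2 (fun p => grad L g p - grad L gbar p) < δ → p (f, g) := by
  rw [nearbyPairs, eventually_inf_principal, eventually_comap, Metric.eventually_nhds_iff] at h
  obtain ⟨δ, hδ, h⟩ := h
  refine ⟨δ, hδ, fun f g hfg hlt => h (y := _) ?_ (f, g) rfl hfg⟩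
  rw [Real.dist_eq, sub_zero, abs_of_nonneg (add_nonneg (cNorm_nonneg _ _) (cNorm_nonneg _ _))]
  exact hlt

lemma eventually_nearbyPairs {ε : ℝ} (hε : 0 < ε) :
    ∀ᶠ fg in nearbyPairs L P₁ P₂ fbar gbar, AdmissiblePair L P₁ P₂ fg.1 fg.2 ∧
      cNorm L P₁ P₂ 2 (fun p => grad L fg.1 p - grad L fbar p) ≤ ε ∧
      cNorm L P₁ P₂ 2 (fun p => grad L fg.2 p - grad L gbar p) ≤ ε := by
  have h1 : ∀ᶠ fg in nearbyPairs L P₁ P₂ fbar gbar,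
      cNorm L P₁ P₂ 2 (fun p => grad L fg.1 p - grad L fbar p)
        + cNorm L P₁ P₂ 2 (fun p => grad L fg.2 p - grad L gbar p) < ε :=
    (tendsto_comap.mono_left inf_le_left).eventually (gt_mem_nhds hε)
  have h2 : ∀ᶠ fg in nearbyPairs L P₁ P₂ fbar gbar, AdmissiblePair L P₁ P₂ fg.1 fg.2 :=
    mem_inf_of_right (mem_principal_self _)
  filter_upwards [h1, h2] with fg h hfg
  have n1 := cNorm_nonneg (L := L) (P₁ := P₁) (P₂ := P₂) 2 (fun p => grad L fg.1 p - grad L fbar p)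
  have n2 := cNorm_nonneg (L := L) (P₁ := P₁) (P₂ := P₂) 2 (fun p => grad L fg.2 p - grad L gbar p)
  exact ⟨hfg, by linarith, by linarith⟩

lemma tendsVec2_grad_fst (hL : 0 < L) (hP₁ : 0 < P₁) (hP₂ : 0 < P₂)
    (ha : ∀ p ∈ closedSlab L, grad L fbar p = a) :
    TendsVec2 (nearbyPairs L P₁ P₂ fbar gbar) L P₁ P₂ a fun fg => grad L fg.1 := fun i => by
  simp only [grad_apply]
  constructor
  · intro ε hε
    filter_upwards [eventually_nearbyPairs hε] with fg h using (nearConst_of_cNorm hL hP₁ hP₂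
      h.1.contDiff_fst h.1.periodic_fst ha h.2.1 i).1
  · intro j ε hε
    filter_upwards [eventually_nearbyPairs hε] with fg h using (nearConst_of_cNorm hL hP₁ hP₂
      h.1.contDiff_fst h.1.periodic_fst ha h.2.1 i).2 j

lemma tendsVec2_grad_snd (hL : 0 < L) (hP₁ : 0 < P₁) (hP₂ : 0 < P₂)
    (hb : ∀ p ∈ closedSlab L, grad L gbar p = b) :
    TendsVec2 (nearbyPairs L P₁ P₂ fbar gbar) L P₁ P₂ b fun fg => grad L fg.2 := fun i => by
  simp only [grad_apply]
  constructor
  · intro ε hε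
    filter_upwards [eventually_nearbyPairs hε] with fg h using (nearConst_of_cNorm hL hP₁ hP₂
      h.1.contDiff_snd h.1.periodic_snd hb h.2.2 i).1
  · intro j ε hε
    filter_upwards [eventually_nearbyPairs hε] with fg h using (nearConst_of_cNorm hL hP₁ hP₂
      h.1.contDiff_snd h.1.periodic_snd hb h.2.2 i).2 j

/-! ### The Poincaré multiplier -/

/-- The multiplier in the Poincaré inequality: completing the square in `(v · ∇F - q F)²` and
integrating by parts gives `∫ (v · ∇F)² ≥ -∫ (div (q v) + q²) F²`. It is linear in `x` and vanishes
in the middle of the slab; `s` is the first component of the constant velocity. -/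
noncomputable def poincareMultiplier (L s : ℝ) (p : E3) : ℝ := 2 * s / L ^ 2 * (L / 2 - p 0)

lemma contDiff_poincareMultiplier (L s : ℝ) : ContDiff ℝ ∞ (poincareMultiplier L s) := by
  unfold poincareMultiplier
  fun_prop

lemma pd_poincareMultiplier (hL : 0 < L) (s : ℝ) {p : E3} (hp : p ∈ closedSlab L) (j : Fin 3) :
    pd L j (poincareMultiplier L s) p = if j = 0 then -(2 * s / L ^ 2) else 0 := by
  rw [pd_eq_fderiv hL ((contDiff_poincareMultiplier L s).of_le (by simp)) hp]
  have h := hasFDerivAt_coord_comp (ψ := fun t => 2 * s / L ^ 2 * (L / 2 - t)) (by fun_prop) 0 p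
  have hd : deriv (fun t : ℝ => 2 * s / L ^ 2 * (L / 2 - t)) (p 0) = -(2 * s / L ^ 2) := by
    have h1 : HasDerivAt (fun t : ℝ => 2 * s / L ^ 2 * (L / 2 - t)) (2 * s / L ^ 2 * (-1)) (p 0) :=
      ((hasDerivAt_id (p 0)).const_sub (L / 2)).const_mul _
    rw [h1.deriv]
    ring
  have h' : fderiv ℝ (poincareMultiplier L s) p = _ := h.fderiv
  rw [h', hd]
  fin_cases j <;> simp

lemma periodicC1Field_poincare (s : ℝ) {V : E3 → E3} (hV : PeriodicC1Field L P₁ P₂ V) :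
    PeriodicC1Field L P₁ P₂ fun p => poincareMultiplier L s p • V p where
  contDiff j := by
    simp only [PiLp.smul_apply, smul_eq_mul]
    exact ((contDiff_poincareMultiplier L s).of_le (by simp)).contDiffOn.mul (hV.contDiff j)
  periodic j := by
    have hq : PeriodicYZ L P₁ P₂ (poincareMultiplier L s) := fun p _ => by
      simp [poincareMultiplier, pt]
    exact hq.map₂ (· * ·) (hV.periodic j)

lemma poincare_bound (hL : 0 < L) {s ε η : ℝ} (hη : η * (2 * |s| / L ^ 2 + |s| / L) ≤ ε)
    {V : E3 → E3} (hV : PeriodicC1Field L P₁ P₂ V) {p : E3} (hp : p ∈ closedSlab L)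
    (h0 : |V p 0 - s| ≤ η) (hdiv : |vdiv L V p| ≤ η) :
    s ^ 2 / L ^ 2 - ε ≤ -(vdiv L (fun p => poincareMultiplier L s p • V p) p
      + poincareMultiplier L s p ^ 2) := by
  have hq1 : ContDiffOn ℝ 1 (poincareMultiplier L s) (closedSlab L) :=
    ((contDiff_poincareMultiplier L s).of_le (by simp)).contDiffOn
  have e1 : vdiv L (fun p => poincareMultiplier L s p • V p) p =
      poincareMultiplier L s p * vdiv L V p - 2 * s / L ^ 2 * V p 0 := by
    have h (j : Fin 3) := pd_mul (j := j) hL hq1 (hV.contDiff j) hp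
    simp only [vdiv, PiLp.smul_apply, smul_eq_mul, h, pd_poincareMultiplier hL s hp,
      Fin.sum_univ_three]
    simp
    ring
  have hx : |L / 2 - p 0| ≤ L / 2 := abs_le.2 ⟨by linarith [hp.2], by linarith [hp.1]⟩
  have hq : |poincareMultiplier L s p| ≤ |s| / L := by
    rw [poincareMultiplier, abs_mul, abs_div, abs_mul, abs_two,
      abs_of_pos (by positivity : 0 < L ^ 2)]
    calc 2 * |s| / L ^ 2 * |L / 2 - p 0| ≤ 2 * |s| / L ^ 2 * (L / 2) := by gcongr
      _ = |s| / L := by field_simp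
  have hq2 : poincareMultiplier L s p ^ 2 ≤ s ^ 2 / L ^ 2 := by
    rw [← sq_abs, ← sq_abs s, ← div_pow]
    gcongr
  have t1 : |poincareMultiplier L s p * vdiv L V p| ≤ |s| / L * η := by
    rw [abs_mul]
    gcongr
  have t2 : |2 * s / L ^ 2 * (V p 0 - s)| ≤ 2 * |s| / L ^ 2 * η := by
    rw [abs_mul, abs_div, abs_mul, abs_two, abs_of_pos (by positivity : 0 < L ^ 2)]
    gcongr
  have e2 : 2 * s / L ^ 2 * V p 0 = 2 * s / L ^ 2 * (V p 0 - s) + 2 * (s ^ 2 / L ^ 2) := by ring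
  rw [e1, e2]
  have := (abs_le.1 t1).2
  have := (abs_le.1 t2).1
  linarith

end

end SteadyEuler

open SteadyEuler
theorem mainTheorem5 (L P₁ P₂ : ℝ) (hL : 0 < L) (hP₁ : 0 < P₁) (hP₂ : 0 < P₂)
    (fbar gbar : E3 → ℝ)
    (hfbar : ContDiffOn ℝ ∞ fbar (closedSlab L)) (hgbar : ContDiffOn ℝ ∞ gbar (closedSlab L))
    (a b : E3)
    (ha : ∀ p ∈ closedSlab L, grad L fbar p = a)
    (hb : ∀ p ∈ closedSlab L, grad L gbar p = b)
    (hv : cross a b 0 ≠ 0)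
    (hnorm : ‖a‖ ^ 2 + ‖b‖ ^ 2
      + √((‖a‖ ^ 2 + ‖b‖ ^ 2) ^ 2 - 4 * ‖cross a b‖ ^ 2) ≤ 2) :
    ∃ C δ : ℝ, 0 ≤ C ∧ 0 < δ ∧
      ∀ f g : E3 → ℝ, AdmissiblePair L P₁ P₂ f g →
        cNorm L P₁ P₂ 2 (fun p => grad L f p - grad L fbar p)
          + cNorm L P₁ P₂ 2 (fun p => grad L g p - grad L gbar p) < δ →
        ∀ H : ℝ × ℝ → ℝ, AdmissibleH L P₁ P₂ f g H →
        ∀ (F : E3 → ℝ) (DF : E3 → E3) (G : E3 → ℝ) (DG : E3 → E3),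
          AdmissibleVariation L P₁ P₂ F DF → AdmissibleVariation L P₁ P₂ G DG →
          secondVariation L P₁ P₂ H f g F DF G DG F DF G DG ≥
            ∫ p in cell L P₁ P₂,
              ((1 / 16 : ℝ) * (dot (velocity L f g p) (DF p)) ^ 2
                + (1 / 16 : ℝ) * (dot (velocity L f g p) (DG p)) ^ 2
                + (1 - C * derivSup L P₁ P₂ (velocity L f g))
                  * (Real.pi ^ 2 * minSqFst L P₁ P₂ (velocity L f g) / (16 * L ^ 2))
                  * (F p ^ 2 + G p ^ 2)
                + Hff H (f p, g p) * F p ^ 2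
                + 2 * Hfg H (f p, g p) * (F p * G p)
                + Hgg H (f p, g p) * G p ^ 2) := by
  set l := nearbyPairs L P₁ P₂ fbar gbar
  set s := cross a b 0 with hs
  set ρ := dot (cross a b) (cross a b) with hρ
  have hs2 : 0 < s ^ 2 := by positivity
  have hsρ : s ^ 2 ≤ ρ := by
    rw [hρ, dot_eq_sum, Fin.sum_univ_three, ← hs]
    nlinarith [mul_self_nonneg (cross a b 1), mul_self_nonneg (cross a b 2)]
  have hρ0 : 0 < ρ := hs2.trans_le hsρ
  obtain ⟨hρ1, hgram⟩ := gram_lower_bound hnorm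
  rw [← hρ] at hρ1 hgram
  -- The size of the perturbation terms that the gap `7/8 - 10/16 = 1/4` between the constants
  -- absorbs.
  obtain ⟨ε, hε, hε1, hε2⟩ : ∃ ε : ℝ, 0 < ε ∧ ε ≤ 1 / 32 ∧ 24 * (1 + L ^ 2) * ε ≤ s ^ 2 := by
    refine ⟨min (1 / 32) (s ^ 2 / (24 * (1 + L ^ 2))), by positivity, min_le_left _ _, ?_⟩
    calc _ ≤ 24 * (1 + L ^ 2) * (s ^ 2 / (24 * (1 + L ^ 2))) := by gcongr; exact min_le_right _ _
      _ = s ^ 2 := by field_simp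
  obtain ⟨η, hη, hη1, hη2, hη3⟩ : ∃ η : ℝ, 0 < η ∧ η ≤ ε ∧ 100 * η ≤ ρ ∧
      η * (2 * |s| / L ^ 2 + |s| / L) ≤ ε := by
    have hK : 0 < 2 * |s| / L ^ 2 + |s| / L := by positivity
    refine ⟨min ε (min (ρ / 100) (ε / (2 * |s| / L ^ 2 + |s| / L))), by positivity,
      min_le_left _ _, ?_, ?_⟩
    · have := (min_le_right ε (min (ρ / 100) (ε / (2 * |s| / L ^ 2 + |s| / L)))).trans
        (min_le_left _ _)
      linarith
    · rw [← le_div_iff₀ hK]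
      exact (min_le_right _ _).trans (min_le_right _ _)
  have tA : TendsVec2 l L P₁ P₂ a fun fg => grad L fg.1 := tendsVec2_grad_fst hL hP₁ hP₂ ha
  have tB : TendsVec2 l L P₁ P₂ b fun fg => grad L fg.2 := tendsVec2_grad_snd hL hP₁ hP₂ hb
  have tV : TendsVec2 l L P₁ P₂ (cross a b) fun fg => velocity L fg.1 fg.2 := tA.cross hL tB
  have tW : TendsVec1 l L P₁ P₂ 0 fun fg => vcurl L (velocity L fg.1 fg.2) := tV.tendsVec1_vcurl hL
  have tρ := tV.toVec1.dot hL tV.toVec1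
  have tinv := tρ.inv hL hρ0.ne'
  have tBV := tB.toVec1.cross hL tV.toVec1
  have tVA := tV.toVec1.cross hL tA.toVec1
  have t1 := ((tW.dot hL tA.toVec1).mul hL tinv).of_eq (d := 0) (by simp [dot])
  have t2 := ((tW.dot hL tB.toVec1).mul hL tinv).of_eq (d := 0) (by simp [dot])
  have t3 := ((tW.dot hL tV.toVec1).mul hL tinv).of_eq (d := 0) (by simp [dot])
  have tX := tBV.smul_zero hL t1
  have tX' := tBV.smul_zero hL t2
  have tY := tVA.smul_zero hL t1
  have hall : ∀ᶠ fg in l, ∀ H : ℝ × ℝ → ℝ, AdmissibleH L P₁ P₂ fg.1 fg.2 H →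
      ∀ (F : E3 → ℝ) (DF : E3 → E3) (G : E3 → ℝ) (DG : E3 → E3),
      AdmissibleVariation L P₁ P₂ F DF → AdmissibleVariation L P₁ P₂ G DG →
      ∫ p in cell L P₁ P₂,
        ((1 / 16 : ℝ) * (dot (velocity L fg.1 fg.2 p) (DF p)) ^ 2
          + (1 / 16 : ℝ) * (dot (velocity L fg.1 fg.2 p) (DG p)) ^ 2
          + Real.pi ^ 2 * minSqFst L P₁ P₂ (velocity L fg.1 fg.2) / (16 * L ^ 2)
            * (F p ^ 2 + G p ^ 2)
          + Hff H (fg.1 p, fg.2 p) * F p ^ 2 + 2 * Hfg H (fg.1 p, fg.2 p) * (F p * G p)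
          + Hgg H (fg.1 p, fg.2 p) * G p ^ 2) ≤
        secondVariation L P₁ P₂ H fg.1 fg.2 F DF G DG F DF G DG := by
    filter_upwards [eventually_nearbyPairs one_pos, tV.toVec1.periodicC1Field, tX.periodicC1Field,
      tX'.periodicC1Field, tY.periodicC1Field, t1.abs_le hε, t2.abs_le hε, t3.abs_le hε,
      tX.abs_vdiv_le hε, tX'.abs_vdiv_le hε, tY.abs_vdiv_le hε, tρ.abs_sub_le hη,
      (tA.toVec1.dot hL tA.toVec1).abs_sub_le hη, (tB.toVec1.dot hL tB.toVec1).abs_sub_le hη,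
      (tA.toVec1.dot hL tB.toVec1).abs_sub_le hη, (tV 0).1.abs_sub_le hη, tV.toVec1.abs_vdiv_le hη,
      ((tV 0).1.mul hL (tV 0).1).abs_sub_le hε] with fg hadm hV hX hX' hY h1 h2 h3 hdX hdX' hdY
      hvv hAA hBB hAB hv0 hdV hv00 H hH F DF G DG hF hG
    have hpos : ∀ p ∈ closedSlab L,
        0 < dot (velocity L fg.1 fg.2 p) (velocity L fg.1 fg.2 p) := fun p hp => by
      have := (abs_le.1 (hvv p hp)).1
      rw [← hρ] at this
      linarith
    refine secondVariation_ge_of_pointwise (ε := ε) (κ := s ^ 2 / L ^ 2) hL hP₁ hP₂ hadm.1 hH hF hG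
      hV hX hX' hY (periodicC1Field_poincare s hV) (fun p hp Q => ?_) hε1 ?_
      (fun p hp P Q => ?_) h1 h2 h3 hdX hdX' hdY
      (fun p hp => poincare_bound hL hη3 hV hp (hv0 p hp) (hdV p hp))
    · have h := dot_basis_expansion (grad L fg.1 p) (grad L fg.2 p)
        (vcurl L (velocity L fg.1 fg.2) p) Q
      have hne := (hpos p hp).ne'
      have hvel : cross (grad L fg.1 p) (grad L fg.2 p) = velocity L fg.1 fg.2 p := rfl
      rw [hvel] at h
      field_simp
      linear_combination h
    · have hmem : pt 0 0 0 ∈ closedCell L P₁ P₂ := by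
        simp [closedCell, pt, hL.le, hP₁.le, hP₂.le]
      have hmin : minSqFst L P₁ P₂ (velocity L fg.1 fg.2) ≤
          velocity L fg.1 fg.2 (pt 0 0 0) 0 ^ 2 := by
        refine csInf_le ⟨0, ?_⟩ (mem_image_of_mem _ hmem)
        rintro _ ⟨q, -, rfl⟩
        positivity
      have hm0 : 0 ≤ minSqFst L P₁ P₂ (velocity L fg.1 fg.2) := by
        refine Real.sInf_nonneg ?_
        rintro _ ⟨q, -, rfl⟩
        positivity
      have hle : minSqFst L P₁ P₂ (velocity L fg.1 fg.2) ≤ s ^ 2 + ε := by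
        have := (abs_le.1 (hv00 _ (closedCell_subset_closedSlab hmem))).2
        rw [← hs] at this
        nlinarith
      have hpi : Real.pi ^ 2 ≤ 10 := by nlinarith [Real.pi_lt_d2, Real.pi_pos]
      have hnum : Real.pi ^ 2 * minSqFst L P₁ P₂ (velocity L fg.1 fg.2) ≤ 10 * (s ^ 2 + ε) := by
        gcongr
      calc Real.pi ^ 2 * minSqFst L P₁ P₂ (velocity L fg.1 fg.2) / (16 * L ^ 2)
          ≤ 10 * (s ^ 2 + ε) / (16 * L ^ 2) := by gcongr
        _ ≤ 7 / 8 * (s ^ 2 / L ^ 2) - 5 * ε := by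
          rw [div_le_iff₀ (by positivity)]
          field_simp
          nlinarith [mul_pos hε (pow_pos hL 2)]
    · exact variation_lower_bound (hη1.trans (by linarith)) hη2 hρ1 hgram (hpos p hp)
        (hAA p hp) (hBB p hp) (hAB p hp) (hvv p hp)
  obtain ⟨δ, hδ, h⟩ := exists_delta_of_eventually hall
  -- The derivative of the velocity is small near the reference pair, so it can be absorbed like
  -- the second derivatives, and the estimate holds with `C = 0`.
  refine ⟨0, δ, le_rfl, hδ, fun f g hfg hlt H hH F DF G DG hF hG => ?_⟩
  simpa using h f g hfg hlt H hH F DF G DG hF hG
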